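/- Let $V$ be a complex vector space with a bilinear form $\sigma$ and a basis $y_1,\dots,y_n$ ($n\ge 0$) such that $\sigma(y_i,y_j)=\delta_{ij}$, and let $x_1,\dots,x_n\in V^*$ be the dual basis. Let $\mathcal W$ be the Weyl algebra of $V\oplus V^*$, i.e. the quotient of the tensor algebra by the relations $vv'-v'v=\omega(v,v')$, where $\omega$ is the symplectic form with $\omega(y,y')=0=\omega(x,x')$ and $\omega(y,x)=x(y)=-\omega(x,y)$ for $y,y'\in V$, $x,x'\in V^*$ (so $[y_i,x_j]=\delta_{ij}$). Let $\mathcal C$ be the Clifford algebra of $(V,\sigma)$, with generators $e_i$ (the images of the $y_i$) satisfying $e_ie_j+e_je_i=2\delta_{ij}$, and let $\mathcal{WC}=\mathcal W\otimes_{\mathbb C}\mathcal C$, with the $\mathbb Z_2$-grading $\mathcal{WC}_{\bar p}=\mathcal W\otimes\mathcal C_{\bar p}$ induced by that of $\mathcal C$ and with the graded commutator $[a,b]=ab-(-1)^{|a||b|}ba$. Let $\mathfrak{spo}(2|1)\subset\mathcal{WC}$ be the Lie sub-superalgebra generated by $\sum_j y_j\otimes e_j$ and $\sum_j x_j\otimes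 e_j$, and let the total angular momentum algebra $\mathfrak O$ be the centralizer of $\mathfrak{spo}(2|1)$ in $\mathcal{WC}$ with respect to the graded commutator, with even part $\mathfrak O_{\bar 0}=\mathfrak O\cap\mathcal{WC}_{\bar 0}$. Put $L_{ij}=x_iy_j-x_jy_i$ and $O_{ij}=L_{ij}+\tfrac12 e_ie_j\in\mathcal{WC}$ for $i<j$. Let $\mathfrak{so}(n,\mathbb C)=\{X\in \mathrm{Mat}_n(\mathbb C)\mid X^T+X=0\}$, and let $X_{ij}=E_{ij}-E_{ji}$. Then there is a unique homomorphism of unital $\mathbb C$-algebras $\mathcal U(\mathfrak{so}(n,\mathbb C))\to\mathfrak O$ that sends $X_{ij}$ to $O_{ij}$ for all $1\le i<j\le n$, and its image is exactly $\mathfrak O_{\bar 0}$. -/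

import Mathlib

noncomputable section

open scoped TensorProduct

namespace AngularMomentum

/-! ### The Weyl algebra -/

section Weyl

variable {M : Type*} [AddCommGroup M] [Module ℂ M]

/-- The relations `v v' - v' v = ω(v, v')` of the Weyl algebra, on the tensor algebra. -/
inductive WeylRel (ω : LinearMap.BilinForm ℂ M) : TensorAlgebra ℂ M → TensorAlgebra ℂ M → Prop
  | comm (v v' : M) : WeylRel ω
      (TensorAlgebra.ι ℂ v * TensorAlgebra.ι ℂ v' - TensorAlgebra.ι ℂ v' * TensorAlgebra.ι ℂ v)
      (algebraMap ℂ (TensorAlgebra ℂ M) (ω v v'))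

/-- The Weyl algebra `T(M) / (v ⊗ v' - v' ⊗ v - ω(v, v'))`. -/
def WeylAlgebra (ω : LinearMap.BilinForm ℂ M) : Type _ := RingQuot (WeylRel ω)

instance (ω : LinearMap.BilinForm ℂ M) : Ring (WeylAlgebra ω) :=
  inferInstanceAs (Ring (RingQuot (WeylRel ω)))

instance (ω : LinearMap.BilinForm ℂ M) : Algebra ℂ (WeylAlgebra ω) :=
  inferInstanceAs (Algebra ℂ (RingQuot (WeylRel ω)))

/-- The canonical linear map from `M` to its Weyl algebra. -/
def WeylAlgebra.ι (ω : LinearMap.BilinForm ℂ M) : M →ₗ[ℂ] WeylAlgebra ω :=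
  (RingQuot.mkAlgHom ℂ (WeylRel ω)).toLinearMap ∘ₗ TensorAlgebra.ι ℂ

end Weyl

variable {V : Type*} [AddCommGroup V] [Module ℂ V]

variable (V) in
/-- The symplectic form on `V ⊕ V*`: `ω(y, x) = ⟨y, x⟩ = -ω(x, y)`, and `V`, `V*` are isotropic. -/
def symplecticForm : LinearMap.BilinForm ℂ (V × Module.Dual ℂ V) :=
  LinearMap.mk₂ ℂ (fun v v' => v'.2 v.1 - v.2 v'.1)
    (fun _ _ _ => by simp; ring) (fun _ _ _ => by simp; ring)
    (fun _ _ _ => by simp; ring) (fun _ _ _ => by simp; ring)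

/-! ### The Weyl-Clifford algebra and its grading -/

/-- The Clifford algebra of `(V, σ)`, in which `v ^ 2 = σ(v, v)`. -/
abbrev Cliff (σ : LinearMap.BilinForm ℂ V) : Type _ := CliffordAlgebra σ.toQuadraticMap

/-- The Weyl-Clifford algebra. -/
abbrev WeylCliff (σ : LinearMap.BilinForm ℂ V) : Type _ :=
  WeylAlgebra (symplecticForm V) ⊗[ℂ] Cliff σ

/-- The homogeneous parts `W ⊗ C_0` and `W ⊗ C_1` of the Weyl-Clifford algebra. -/
def gradedPart (σ : LinearMap.BilinForm ℂ V) (p : ZMod 2) : Submodule ℂ (WeylCliff σ) :=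
  LinearMap.range (LinearMap.lTensor (WeylAlgebra (symplecticForm V))
    (CliffordAlgebra.evenOdd σ.toQuadraticMap p).subtype)

/-- The automorphism of the Weyl-Clifford algebra that is `1` on the even part
and `-1` on the odd part. -/
def parity (σ : LinearMap.BilinForm ℂ V) : WeylCliff σ →ₐ[ℂ] WeylCliff σ :=
  Algebra.TensorProduct.map (AlgHom.id ℂ _) CliffordAlgebra.involute

/-- The projection of the Weyl-Clifford algebra to its odd part. -/
def oddProj (σ : LinearMap.BilinForm ℂ V) : WeylCliff σ →ₗ[ℂ] WeylCliff σ :=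
  (2⁻¹ : ℂ) • (LinearMap.id - (parity σ).toLinearMap)

/-- The graded commutator: the bilinear map that is `a b - (-1) ^ (|a| |b|) b a` on homogeneous
elements (see `superBracket_of_mem`). -/
def superBracket (σ : LinearMap.BilinForm ℂ V) (a b : WeylCliff σ) : WeylCliff σ :=
  a * b - b * a + (2 : ℂ) • (oddProj σ b * oddProj σ a)

theorem parity_of_mem (σ : LinearMap.BilinForm ℂ V) {p : ZMod 2} {a : WeylCliff σ}
    (ha : a ∈ gradedPart σ p) : parity σ a = (-1 : ℂ) ^ p.val • a := by
  obtain ⟨t, rfl⟩ := ha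
  induction t using TensorProduct.induction_on with
  | zero => simp
  | add s t hs ht => rw [map_add, map_add, hs, ht, smul_add]
  | tmul w c =>
    have hc : CliffordAlgebra.involute (c : Cliff σ) = (-1 : ℂ) ^ p.val • (c : Cliff σ) := by
      fin_cases p
      · simpa [ZMod.val] using CliffordAlgebra.involute_eq_of_mem_even c.2
      · simpa [ZMod.val] using CliffordAlgebra.involute_eq_of_mem_odd c.2
    simp [parity, hc]

theorem superBracket_of_mem (σ : LinearMap.BilinForm ℂ V) {p q : ZMod 2} {a b : WeylCliff σ}
    (ha : a ∈ gradedPart σ p) (hb : b ∈ gradedPart σ q) :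
    superBracket σ a b = a * b - (-1 : ℂ) ^ (p.val * q.val) • (b * a) := by
  have h1 := parity_of_mem σ ha
  have h2 := parity_of_mem σ hb
  have e : (2 : ℂ) • (b * a) = b * a + b * a := two_smul ℂ _
  fin_cases p <;> fin_cases q <;>
    simp_all [superBracket, oddProj, ZMod.val, ← two_smul ℂ, smul_smul]
  rw [sub_add, two_smul]
  abel

/-! ### The generators and the total angular momentum algebra -/

section Generators

variable (σ : LinearMap.BilinForm ℂ V) {n : ℕ} (y : Module.Basis (Fin n) ℂ V)

/-- The generator `y_i` of the Weyl algebra. -/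
def wy (i : Fin n) : WeylAlgebra (symplecticForm V) :=
  WeylAlgebra.ι (symplecticForm V) (y i, 0)

/-- The generator `x_i` of the Weyl algebra, from the dual basis of `y`. -/
def wx (i : Fin n) : WeylAlgebra (symplecticForm V) :=
  WeylAlgebra.ι (symplecticForm V) (0, y.coord i)

/-- The generator `e_i` of the Clifford algebra. -/
def ce (i : Fin n) : Cliff σ := CliffordAlgebra.ι σ.toQuadraticMap (y i)

/-- The Dirac operator `∑ y_j ⊗ e_j`. -/
def dirac : WeylCliff σ := ∑ j, wy y j ⊗ₜ[ℂ] ce σ y j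

/-- The dual Dirac operator `∑ x_j ⊗ e_j`. -/
def diracDual : WeylCliff σ := ∑ j, wx y j ⊗ₜ[ℂ] ce σ y j

/-- Lie sub-superalgebras of the Weyl-Clifford algebra: graded subspaces that are closed under the
graded commutator. -/
structure IsLieSubSuperalgebra (S : Submodule ℂ (WeylCliff σ)) : Prop where
  parity_mem : ∀ a ∈ S, parity σ a ∈ S
  bracket_mem : ∀ a ∈ S, ∀ b ∈ S, superBracket σ a b ∈ S

/-- The harmonic Lie superalgebra `spo(2|1)`: the Lie sub-superalgebra generated by the Dirac
operator and its dual. -/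
def spo : Submodule ℂ (WeylCliff σ) :=
  sInf {S | IsLieSubSuperalgebra σ S ∧ dirac σ y ∈ S ∧ diracDual σ y ∈ S}

theorem parity_mem_spo {s : WeylCliff σ} (hs : s ∈ spo σ y) : parity σ s ∈ spo σ y := by
  rw [spo, Submodule.mem_sInf] at hs ⊢
  exact fun S hS => hS.1.parity_mem s (hs S hS)

theorem oddProj_mem_spo {s : WeylCliff σ} (hs : s ∈ spo σ y) : oddProj σ s ∈ spo σ y :=
  Submodule.smul_mem _ _ (Submodule.sub_mem _ hs (parity_mem_spo σ y hs))

theorem parity_parity (a : WeylCliff σ) : parity σ (parity σ a) = a := by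
  have : (parity σ).comp (parity σ) = AlgHom.id ℂ _ := by
    ext <;> simp [parity]
  exact DFunLike.congr_fun this a

theorem oddProj_oddProj (a : WeylCliff σ) : oddProj σ (oddProj σ a) = oddProj σ a := by
  simp only [oddProj, LinearMap.smul_apply, LinearMap.sub_apply, LinearMap.id_apply,
    AlgHom.toLinearMap_apply, map_smul, map_sub, parity_parity]
  module

/-- An element is annihilated by bracketing with `spo(2|1)` iff it commutes with its even elements
and commutes up to parity with its odd elements. -/
theorem superBracket_eq_zero_iff (a : WeylCliff σ) :
    (∀ s ∈ spo σ y, superBracket σ s a = 0) ↔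
      ∀ s ∈ spo σ y, (s - oddProj σ s) * a = a * (s - oddProj σ s) ∧
        oddProj σ s * a = parity σ a * oddProj σ s := by
  have hp : parity σ a = a - (2 : ℂ) • oddProj σ a := by
    simp only [oddProj, LinearMap.smul_apply, LinearMap.sub_apply, LinearMap.id_apply,
      AlgHom.toLinearMap_apply]
    module
  constructor
  · intro h s hs
    have h1 := h _ (oddProj_mem_spo σ y hs)
    have h0 := h _ (Submodule.sub_mem _ hs (oddProj_mem_spo σ y hs))
    simp only [superBracket, map_sub, oddProj_oddProj, sub_self, mul_zero, smul_zero,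
      add_zero] at h0 h1
    refine ⟨sub_eq_zero.mp h0, ?_⟩
    rw [hp, sub_mul, smul_mul_assoc, ← sub_eq_zero, ← h1]
    abel
  · intro h s hs
    obtain ⟨h0, h1⟩ := h s hs
    rw [hp, sub_mul, smul_mul_assoc] at h1
    have : superBracket σ s a = ((s - oddProj σ s) * a - a * (s - oddProj σ s)) +
        (oddProj σ s * a - (a * oddProj σ s - (2 : ℂ) • (oddProj σ a * oddProj σ s))) := by
      rw [superBracket, sub_mul, mul_sub]
      abel
    rw [this, h0, h1]
    abel

/-- The total angular momentum algebra: the centralizer, for the graded commutator, of `spo(2|1)`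
in the Weyl-Clifford algebra. -/
def tama : Subalgebra ℂ (WeylCliff σ) where
  carrier := {a | ∀ s ∈ spo σ y, superBracket σ s a = 0}
  mul_mem' {a b} ha hb := by
    rw [Set.mem_ofPred_eq, superBracket_eq_zero_iff] at *
    intro s hs
    obtain ⟨a0, a1⟩ := ha s hs
    obtain ⟨b0, b1⟩ := hb s hs
    refine ⟨?_, ?_⟩
    · rw [← mul_assoc, a0, mul_assoc, b0, mul_assoc]
    · rw [← mul_assoc, a1, mul_assoc, b1, map_mul, mul_assoc]
  add_mem' {a b} ha hb := by
    rw [Set.mem_ofPred_eq, superBracket_eq_zero_iff] at *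
    intro s hs
    obtain ⟨a0, a1⟩ := ha s hs
    obtain ⟨b0, b1⟩ := hb s hs
    exact ⟨by rw [mul_add, add_mul, a0, b0], by rw [mul_add, map_add, add_mul, a1, b1]⟩
  algebraMap_mem' c := by
    rw [Set.mem_ofPred_eq, superBracket_eq_zero_iff]
    intro s _
    exact ⟨(Algebra.commutes c _).symm, by rw [AlgHom.commutes, Algebra.commutes]⟩

/-- The even part of the total angular momentum algebra. -/
def tamaEven : Submodule ℂ (WeylCliff σ) :=
  Subalgebra.toSubmodule (tama σ y) ⊓ gradedPart σ 0

/-- The angular momentum operator `L_ij = x_i y_j - x_j y_i`. -/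
def angMom (i j : Fin n) : WeylAlgebra (symplecticForm V) :=
  wx y i * wy y j - wx y j * wy y i

/-- The 2-index symmetry `O_ij = L_ij + (1/2) e_i e_j` (for `i ≠ j`). -/
def twoIndex (i j : Fin n) : WeylCliff σ :=
  angMom y i j ⊗ₜ[ℂ] 1 + (2⁻¹ : ℂ) • (1 ⊗ₜ[ℂ] (ce σ y i * ce σ y j))

end Generators

/-- The element `X_ij = E_ij - E_ji` of `so(n, ℂ)`. -/
def soX {n : ℕ} (i j : Fin n) : LieAlgebra.Orthogonal.so (Fin n) ℂ :=
  ⟨Matrix.single i j 1 - Matrix.single j i 1, by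
    rw [LieAlgebra.Orthogonal.mem_so]; simp⟩

end AngularMomentum

end

noncomputable section

open scoped TensorProduct

namespace AngularMomentum

-- Write D = ∑ y_i e_i and D' = ∑ x_i e_i. Against an even element the graded commutator is the
-- ordinary one, and the centralizer of an even element is a Lie sub-superalgebra, so an even
-- element lies in 𝔒 as soon as it commutes with D and D'. A skew matrix acts on the three families
-- x, y, e simultaneously through `rotation`, and D, D' are invariant pairings of these families;
-- this gives the homomorphism into 𝔒. It is unique because the X_ij with i < j span so(n).
--
-- The substance is that the image A exhausts the even part. Let w be even and commute with D and
-- D'.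
--
-- It then commutes with D² = ∑ y_i² and D'² = ∑ x_i². By a first fundamental theorem for sl(2) with
-- even Clifford coefficients (`mem_of_lie_sum_sq_eq_zero`), w is generated over these coefficients
-- by the L_ij; substituting L_ij = O_ij - e_i e_j / 2 puts w in C_0 · A. The theorem rests on the
-- `capelli` identity: for an invariant of degree d, the sum of the L_ij times the polars of w is a
-- nonzero multiple of w modulo lower degree when d > 0, and the polars are again invariants, of
-- lower degree.
--
-- The Clifford coefficients are removed by T z = {D, [D', z]} (`doubleBracket`). It is A-linear,
-- vanishes on whatever commutes with D', and satisfies T² = 2T on C_0. So P = 2 - T doubles w and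
-- kills T(C_0). By `four_smul_doubleBracket`, 4T c is a quadratic polynomial in the number operator
-- N c = ∑ e_k [e_k, c] applied to c, plus products of O_jk with elements of lower Clifford degree.
-- Applying P and inducting on the degree gives P(C_0) ⊆ A (`two_smul_sub_doubleBracket_mem`),
-- whence 2w = P w ∈ P(C_0) · A ⊆ A.

attribute [local instance] LieRing.ofAssociativeRing

/-! ### Invariants of `sl(2)` in a Weyl algebra with coefficients -/

section WeylInvariants

variable {K R ι : Type*} [Field K] [Ring R] [Algebra K R]

/-- The canonical commutation relations. -/
structure WeylRelations [DecidableEq ι] (x y : ι → R) : Prop where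
  xx : ∀ i j, x i * x j = x j * x i
  yy : ∀ i j, y i * y j = y j * y i
  yx : ∀ i j, y i * x j = x j * y i + if i = j then 1 else 0

theorem lie_mul_eq (a b c : R) : ⁅a, b * c⁆ = ⁅a, b⁆ * c + b * ⁅a, c⁆ := by
  simp only [Ring.lie_def]; noncomm_ring

theorem lie_smul_eq (c : K) (a b : R) : ⁅a, c • b⁆ = c • ⁅a, b⁆ := by
  simp only [Ring.lie_def, mul_smul_comm, smul_mul_assoc, smul_sub]

/-- Elements of degree less than `d` in `x` and `y`, with coefficients in `B`. -/
def weylFilt (x y : ι → R) (B : Submodule K R) : ℕ → Submodule K R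
  | 0 => ⊥
  | d + 1 => B ⊔ Submodule.span K (Set.range x ∪ Set.range y) * weylFilt x y B d

variable {x y : ι → R} {B : Submodule K R}

theorem le_weylFilt_succ (d : ℕ) : B ≤ weylFilt x y B (d + 1) := le_sup_left

theorem x_mul_mem_weylFilt (i : ι) {d : ℕ} {w : R} (hw : w ∈ weylFilt x y B d) :
    x i * w ∈ weylFilt x y B (d + 1) :=
  Submodule.mem_sup_right (Submodule.mul_mem_mul (Submodule.subset_span (by simp)) hw)

theorem y_mul_mem_weylFilt (i : ι) {d : ℕ} {w : R} (hw : w ∈ weylFilt x y B d) :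
    y i * w ∈ weylFilt x y B (d + 1) :=
  Submodule.mem_sup_right (Submodule.mul_mem_mul (Submodule.subset_span (by simp)) hw)

theorem weylFilt_le_succ (d : ℕ) : weylFilt x y B d ≤ weylFilt x y B (d + 1) := by
  induction d with
  | zero => exact bot_le
  | succ d ih => exact sup_le_sup_left (mul_le_mul_right ih _) _

theorem weylFilt_mono : Monotone (weylFilt x y B) := monotone_nat_of_le_succ weylFilt_le_succ

theorem weylFilt_succ_induction {d : ℕ} {p : R → Prop} (hB : ∀ b ∈ B, p b)
    (hx : ∀ i, ∀ w ∈ weylFilt x y B d, p (x i * w))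
    (hy : ∀ i, ∀ w ∈ weylFilt x y B d, p (y i * w))
    (hadd : ∀ a b, p a → p b → p (a + b)) (hsmul : ∀ (c : K) a, p a → p (c • a)) :
    ∀ w ∈ weylFilt x y B (d + 1), p w := by
  let S : Submodule K R :=
    { carrier := {a | p a}
      add_mem' := fun ha hb => hadd _ _ ha hb
      zero_mem' := hB 0 B.zero_mem
      smul_mem' := fun c _ ha => hsmul c _ ha }
  have : weylFilt x y B (d + 1) ≤ S := by
    refine sup_le hB (Submodule.mul_le.mpr fun g hg w hw => ?_)
    induction hg using Submodule.span_induction with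
    | mem g hg =>
      rcases hg with ⟨i, rfl⟩ | ⟨i, rfl⟩
      · exact hx i w hw
      · exact hy i w hw
    | zero => rw [zero_mul]; exact S.zero_mem
    | add a b _ _ ha hb => rw [add_mul]; exact S.add_mem ha hb
    | smul c a _ ha => rw [smul_mul_assoc]; exact S.smul_mem c ha
  exact this

/-- If w commutes with ∑ x_i², only the double brackets remain on the right, so the polarization ∑
x_i [x_i, w] has smaller degree than its form suggests. -/
theorem sum_x_mul_lie_x [Fintype ι] (w : R) :
    2 * ∑ i, x i * ⁅x i, w⁆ = ⁅∑ i, x i * x i, w⁆ + ∑ i, ⁅x i, ⁅x i, w⁆⁆ := by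
  rw [sum_lie, Finset.mul_sum, ← Finset.sum_add_distrib]
  refine Finset.sum_congr rfl fun i _ => ?_
  simp only [Ring.lie_def]; noncomm_ring

/-- The same device for the Cartan element of sl(2). With the plus sign the left side is the weight
operator x∂_x - y∂_y up to a factor, not the degree. -/
theorem sum_lie_euler [Fintype ι] (w : R) :
    2 * ∑ i, (x i * ⁅y i, w⁆ + y i * ⁅x i, w⁆) =
      ⁅∑ i, (x i * y i + y i * x i), w⁆ + ∑ i, (⁅y i, ⁅x i, w⁆⁆ + ⁅x i, ⁅y i, w⁆⁆) := by
  rw [sum_lie, Finset.mul_sum, ← Finset.sum_add_distrib]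
  refine Finset.sum_congr rfl fun i _ => ?_
  simp only [Ring.lie_def]; noncomm_ring

/-- The polar is antisymmetric in i and j, so both halves of the angular momentum contribute
equally. -/
theorem sum_angMom_mul_polar [Fintype ι] (w : R) :
    ∑ i, ∑ j, (x i * y j - x j * y i) * (⁅y j, ⁅x i, w⁆⁆ - ⁅y i, ⁅x j, w⁆⁆) =
      2 * ∑ i, ∑ j, x i * y j * (⁅y j, ⁅x i, w⁆⁆ - ⁅y i, ⁅x j, w⁆⁆) := by
  rw [two_mul]
  nth_rw 3 [Finset.sum_comm]
  simp only [← Finset.sum_add_distrib]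
  refine Finset.sum_congr rfl fun i _ => Finset.sum_congr rfl fun j _ => ?_
  noncomm_ring

namespace WeylRelations

variable [DecidableEq ι]

theorem lie_xx (h : WeylRelations x y) (i j : ι) : ⁅x i, x j⁆ = 0 := by
  rw [Ring.lie_def, h.xx, sub_self]

theorem lie_yy (h : WeylRelations x y) (i j : ι) : ⁅y i, y j⁆ = 0 := by
  rw [Ring.lie_def, h.yy, sub_self]

theorem lie_yx (h : WeylRelations x y) (i j : ι) : ⁅y i, x j⁆ = if i = j then 1 else 0 := by
  rw [Ring.lie_def, h.yx, add_sub_cancel_left]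

theorem lie_xy (h : WeylRelations x y) (i j : ι) : ⁅x i, y j⁆ = -if i = j then 1 else 0 := by
  rw [← lie_skew, h.lie_yx]; simp only [eq_comm]

theorem lie_x_lie_x (h : WeylRelations x y) (i j : ι) (w : R) :
    ⁅x i, ⁅x j, w⁆⁆ = ⁅x j, ⁅x i, w⁆⁆ := by
  rw [leibniz_lie, h.lie_xx, zero_lie, zero_add]

theorem lie_y_lie_y (h : WeylRelations x y) (i j : ι) (w : R) :
    ⁅y i, ⁅y j, w⁆⁆ = ⁅y j, ⁅y i, w⁆⁆ := by
  rw [leibniz_lie, h.lie_yy, zero_lie, zero_add]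

/-- Bracketing with a generator is a derivation that kills the coefficients and sends generators to
scalars, so it lowers the degree by one. -/
theorem lie_mem_weylFilt (h : WeylRelations x y) (hBx : ∀ i, ∀ b ∈ B, Commute (x i) b)
    (hBy : ∀ i, ∀ b ∈ B, Commute (y i) b) (i : ι) (d : ℕ) :
    ∀ w ∈ weylFilt x y B (d + 1), ⁅x i, w⁆ ∈ weylFilt x y B d ∧ ⁅y i, w⁆ ∈ weylFilt x y B d := by
  induction d with
  | zero =>
    refine weylFilt_succ_induction (fun b hb => ?_) (fun j w hw => ?_) (fun j w hw => ?_)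
      (fun a b ha hb => ?_) (fun c a ha => ?_)
    · rw [(hBx i b hb).lie_eq, (hBy i b hb).lie_eq]
      exact ⟨zero_mem _, zero_mem _⟩
    · rw [(Submodule.mem_bot K).mp hw]; simp
    · rw [(Submodule.mem_bot K).mp hw]; simp
    · rw [lie_add, lie_add]; exact ⟨add_mem ha.1 hb.1, add_mem ha.2 hb.2⟩
    · rw [lie_smul_eq, lie_smul_eq]
      exact ⟨Submodule.smul_mem _ _ ha.1, Submodule.smul_mem _ _ ha.2⟩
  | succ d ih =>
    have key (p : Prop) [Decidable p] {w : R} (hw : w ∈ weylFilt x y B (d + 1)) :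
        (if p then (1 : R) else 0) * w ∈ weylFilt x y B (d + 1) := by
      split_ifs <;> simp [hw]
    refine weylFilt_succ_induction (fun b hb => ?_) (fun j w hw => ?_) (fun j w hw => ?_)
      (fun a b ha hb => ?_) (fun c a ha => ?_)
    · rw [(hBx i b hb).lie_eq, (hBy i b hb).lie_eq]
      exact ⟨zero_mem _, zero_mem _⟩
    · rw [lie_mul_eq, lie_mul_eq, h.lie_xx, h.lie_yx, zero_mul, zero_add]
      exact ⟨x_mul_mem_weylFilt j (ih w hw).1, add_mem (key _ hw) (x_mul_mem_weylFilt j (ih w hw).2)⟩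
    · rw [lie_mul_eq, lie_mul_eq, h.lie_yy, h.lie_xy, zero_mul, zero_add, neg_mul]
      exact ⟨add_mem (neg_mem (key _ hw)) (y_mul_mem_weylFilt j (ih w hw).1),
        y_mul_mem_weylFilt j (ih w hw).2⟩
    · rw [lie_add, lie_add]; exact ⟨add_mem ha.1 hb.1, add_mem ha.2 hb.2⟩
    · rw [lie_smul_eq, lie_smul_eq]
      exact ⟨Submodule.smul_mem _ _ ha.1, Submodule.smul_mem _ _ ha.2⟩

theorem lie_mem_weylFilt_self (h : WeylRelations x y) (hBx : ∀ i, ∀ b ∈ B, Commute (x i) b)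
    (hBy : ∀ i, ∀ b ∈ B, Commute (y i) b) (i : ι) {d : ℕ} {w : R} (hw : w ∈ weylFilt x y B d) :
    ⁅x i, w⁆ ∈ weylFilt x y B d ∧ ⁅y i, w⁆ ∈ weylFilt x y B d :=
  h.lie_mem_weylFilt hBx hBy i d w (weylFilt_le_succ d hw)

theorem mul_lie_mem_weylFilt (h : WeylRelations x y) (hBx : ∀ i, ∀ b ∈ B, Commute (x i) b)
    (hBy : ∀ i, ∀ b ∈ B, Commute (y i) b) (i j : ι) {d : ℕ} {w : R}
    (hw : w ∈ weylFilt x y B d) :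
    x i * ⁅y j, w⁆ ∈ weylFilt x y B d ∧ y i * ⁅y j, w⁆ ∈ weylFilt x y B d := by
  cases d with
  | zero => rw [(Submodule.mem_bot K).mp hw]; simp
  | succ d =>
    have := (h.lie_mem_weylFilt hBx hBy j d w hw).2
    exact ⟨x_mul_mem_weylFilt i this, y_mul_mem_weylFilt i this⟩

variable [Fintype ι]

theorem euler_x_mul (h : WeylRelations x y) (j : ι) (w : R) :
    ∑ i, (x i * ⁅y i, x j * w⁆ - y i * ⁅x i, x j * w⁆) =
      x j * w + x j * ∑ i, (x i * ⁅y i, w⁆ - y i * ⁅x i, w⁆) - ⁅x j, w⁆ := by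
  have key (i : ι) : x i * ⁅y i, x j * w⁆ - y i * ⁅x i, x j * w⁆ =
      (if i = j then x j * w else 0) + x j * (x i * ⁅y i, w⁆ - y i * ⁅x i, w⁆) -
        if i = j then ⁅x j, w⁆ else 0 := by
    rw [lie_mul_eq, lie_mul_eq, h.lie_xx, h.lie_yx, zero_mul, zero_add, mul_add, ← mul_assoc (x i),
      ← mul_assoc (x i), ← mul_assoc (y i), h.yx, h.xx i j]
    split_ifs with hij
    · subst hij; noncomm_ring
    · noncomm_ring
  rw [Finset.sum_congr rfl fun i _ => key i, Finset.sum_sub_distrib, Finset.sum_add_distrib,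
    Finset.mul_sum]
  simp only [Finset.sum_ite_eq', Finset.mem_univ, if_true]

theorem euler_y_mul (h : WeylRelations x y) (j : ι) (w : R) :
    ∑ i, (x i * ⁅y i, y j * w⁆ - y i * ⁅x i, y j * w⁆) =
      y j * w + y j * ∑ i, (x i * ⁅y i, w⁆ - y i * ⁅x i, w⁆) - ⁅y j, w⁆ := by
  have key (i : ι) : x i * ⁅y i, y j * w⁆ - y i * ⁅x i, y j * w⁆ =
      (if i = j then y j * w else 0) + y j * (x i * ⁅y i, w⁆ - y i * ⁅x i, w⁆) -
        if i = j then ⁅y j, w⁆ else 0 := by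
    have e : x i * y j = y j * x i - if i = j then 1 else 0 := by
      rw [h.yx]; simp only [eq_comm, add_sub_cancel_right]
    rw [lie_mul_eq, lie_mul_eq, h.lie_yy, h.lie_xy, zero_mul, zero_add, mul_add, ← mul_assoc (x i),
      ← mul_assoc (y i), ← mul_assoc (y i), e, h.yy i j]
    split_ifs with hij
    · subst hij; noncomm_ring
    · noncomm_ring
  rw [Finset.sum_congr rfl fun i _ => key i, Finset.sum_sub_distrib, Finset.sum_add_distrib,
    Finset.mul_sum]
  simp only [Finset.sum_ite_eq', Finset.mem_univ, if_true]

/-- On symbols, bracketing with y_i is ∂/∂x_i and bracketing with x_i is -∂/∂y_i, so the sum is the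
Euler operator. The bound is strict: level d + 1 has top degree d, hence the eigenvalue d. -/
theorem euler_sub_mem_weylFilt (h : WeylRelations x y) (hBx : ∀ i, ∀ b ∈ B, Commute (x i) b)
    (hBy : ∀ i, ∀ b ∈ B, Commute (y i) b) (d : ℕ) :
    ∀ w ∈ weylFilt x y B (d + 1),
      ∑ i, (x i * ⁅y i, w⁆ - y i * ⁅x i, w⁆) - (d : K) • w ∈ weylFilt x y B d := by
  induction d with
  | zero =>
    intro w hw
    have h0 (i : ι) := h.lie_mem_weylFilt hBx hBy i 0 w hw
    simp only [weylFilt, Submodule.mem_bot] at h0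
    simp [h0]
  | succ d ih =>
    refine weylFilt_succ_induction (fun b hb => ?_) (fun j w hw => ?_) (fun j w hw => ?_)
      (fun a b ha hb => ?_) (fun c a ha => ?_)
    · simp only [(hBx _ b hb).lie_eq, (hBy _ b hb).lie_eq, mul_zero, sub_self,
        Finset.sum_const_zero, zero_sub]
      exact neg_mem (Submodule.smul_mem _ _ (le_weylFilt_succ d hb))
    · have e : x j * w + x j * ∑ i, (x i * ⁅y i, w⁆ - y i * ⁅x i, w⁆) - ⁅x j, w⁆ -
          ((d + 1 : ℕ) : K) • (x j * w) =
          x j * (∑ i, (x i * ⁅y i, w⁆ - y i * ⁅x i, w⁆) - (d : K) • w) - ⁅x j, w⁆ := by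
        rw [mul_sub, mul_smul_comm]; push_cast; module
      rw [h.euler_x_mul, e]
      exact sub_mem (x_mul_mem_weylFilt j (ih w hw)) (h.lie_mem_weylFilt_self hBx hBy j hw).1
    · have e : y j * w + y j * ∑ i, (x i * ⁅y i, w⁆ - y i * ⁅x i, w⁆) - ⁅y j, w⁆ -
          ((d + 1 : ℕ) : K) • (y j * w) =
          y j * (∑ i, (x i * ⁅y i, w⁆ - y i * ⁅x i, w⁆) - (d : K) • w) - ⁅y j, w⁆ := by
        rw [mul_sub, mul_smul_comm]; push_cast; module
      rw [h.euler_y_mul, e]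
      exact sub_mem (y_mul_mem_weylFilt j (ih w hw)) (h.lie_mem_weylFilt_self hBx hBy j hw).2
    · simp only [lie_add, mul_add, add_sub_add_comm, Finset.sum_add_distrib, smul_add] at ha hb ⊢
      exact add_mem ha hb
    · have := Submodule.smul_mem _ c ha
      rw [smul_sub, smul_comm c, Finset.smul_sum] at this
      simpa only [lie_smul_eq, mul_smul_comm, smul_sub] using this

/-- The Capelli identity for a pair of vectors. -/
theorem capelli (h : WeylRelations x y) (w : R) :
    ∑ i, ∑ j, x i * y j * (⁅y j, ⁅x i, w⁆⁆ - ⁅y i, ⁅x j, w⁆⁆) =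
      (∑ j, y j * ⁅y j, ∑ i, x i * ⁅x i, w⁆⁆) - (∑ i, x i * ⁅y i, ∑ j, y j * ⁅x j, w⁆⁆)
        - (∑ j, y j * ⁅x j, w⁆) - ∑ i, ⁅y i, ⁅x i, w⁆⁆ := by
  have e1 (i j : ι) : x i * ⁅y i, y j * ⁅x j, w⁆⁆ = x i * y j * ⁅y i, ⁅x j, w⁆⁆ := by
    rw [lie_mul_eq, h.lie_yy, zero_mul, zero_add, mul_assoc]
  -- Moving y_j past x_i costs a scalar on the diagonal; these terms become the two first-line
  -- corrections of the identity.
  have e2 (i j : ι) : y j * ⁅y j, x i * ⁅x i, w⁆⁆ = x i * y j * ⁅y j, ⁅x i, w⁆⁆ +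
      ((if i = j then y i * ⁅x i, w⁆ else 0) + if i = j then ⁅y i, ⁅x i, w⁆⁆ else 0) := by
    rw [lie_mul_eq, h.lie_yx, mul_add, ← mul_assoc (y j) (x i), h.yx]
    simp only [eq_comm (a := j)]
    split_ifs with hij
    · subst hij; noncomm_ring
    · noncomm_ring
  simp only [lie_sum, Finset.mul_sum, e1, mul_sub, Finset.sum_sub_distrib]
  rw [Finset.sum_comm (f := fun j i => y j * ⁅y j, x i * ⁅x i, w⁆⁆)]
  simp only [e2, Finset.sum_add_distrib, Finset.sum_ite_eq, Finset.mem_univ, if_true]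
  abel

/-! ### The sl(2)-triple and the elements that commute with it -/

theorem lie_sum_sq_sum_sq (h : WeylRelations x y) :
    ⁅∑ i, y i * y i, ∑ i, x i * x i⁆ = 2 * ∑ i, (x i * y i + y i * x i) := by
  have key (i j : ι) : ⁅y i * y i, x j * x j⁆ =
      if i = j then 2 * (x i * y i + y i * x i) else 0 := by
    have e : ⁅y i * y i, x j * x j⁆ = y i * (⁅y i, x j⁆ * x j + x j * ⁅y i, x j⁆) +
        (⁅y i, x j⁆ * x j + x j * ⁅y i, x j⁆) * y i := by
      simp only [Ring.lie_def]; noncomm_ring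
    rw [e, h.lie_yx]
    split_ifs with hij
    · subst hij; noncomm_ring
    · simp
  simp only [sum_lie, lie_sum, key, Finset.sum_ite_eq', Finset.mem_univ, if_true, Finset.mul_sum]

theorem lie_sum_y_sq_x (h : WeylRelations x y) (i : ι) : ⁅∑ k, y k * y k, x i⁆ = 2 * y i := by
  have key (k : ι) : ⁅y k * y k, x i⁆ = if k = i then 2 * y i else 0 := by
    have e : ⁅y k * y k, x i⁆ = y k * ⁅y k, x i⁆ + ⁅y k, x i⁆ * y k := by
      simp only [Ring.lie_def]; noncomm_ring
    rw [e, h.lie_yx]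
    split_ifs with hk
    · subst hk; noncomm_ring
    · simp
  simp only [sum_lie, key, Finset.sum_ite_eq', Finset.mem_univ, if_true]

theorem lie_sum_x_sq_y (h : WeylRelations x y) (i : ι) : ⁅∑ k, x k * x k, y i⁆ = -(2 * x i) := by
  have key (k : ι) : ⁅x k * x k, y i⁆ = if k = i then -(2 * x i) else 0 := by
    have e : ⁅x k * x k, y i⁆ = x k * ⁅x k, y i⁆ + ⁅x k, y i⁆ * x k := by
      simp only [Ring.lie_def]; noncomm_ring
    rw [e, h.lie_xy]
    split_ifs with hk
    · subst hk; noncomm_ring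
    · simp
  simp only [sum_lie, key, Finset.sum_ite_eq', Finset.mem_univ, if_true]

theorem lie_sum_y_sq_y (h : WeylRelations x y) (i : ι) : ⁅∑ k, y k * y k, y i⁆ = 0 := by
  rw [sum_lie]
  refine Finset.sum_eq_zero fun k _ => ?_
  have hc : Commute (y k) (y i) := h.yy k i
  exact (hc.mul_left hc).lie_eq

theorem lie_sum_x_sq_x (h : WeylRelations x y) (i : ι) : ⁅∑ k, x k * x k, x i⁆ = 0 := by
  rw [sum_lie]
  refine Finset.sum_eq_zero fun k _ => ?_
  have hc : Commute (x k) (x i) := h.xx k i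
  exact (hc.mul_left hc).lie_eq

theorem lie_sum_y_sq_angMom (h : WeylRelations x y) (i j : ι) :
    ⁅∑ k, y k * y k, x i * y j - x j * y i⁆ = 0 := by
  rw [lie_sub, lie_mul_eq, lie_mul_eq, h.lie_sum_y_sq_x, h.lie_sum_y_sq_x, h.lie_sum_y_sq_y,
    h.lie_sum_y_sq_y, mul_zero, mul_zero, mul_assoc, mul_assoc, h.yy i j, sub_self]

theorem lie_sum_x_sq_angMom (h : WeylRelations x y) (i j : ι) :
    ⁅∑ k, x k * x k, x i * y j - x j * y i⁆ = 0 := by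
  rw [lie_sub, lie_mul_eq, lie_mul_eq, h.lie_sum_x_sq_x, h.lie_sum_x_sq_x, h.lie_sum_x_sq_y,
    h.lie_sum_x_sq_y, zero_mul, zero_mul, mul_neg, mul_neg, two_mul, two_mul, mul_add, mul_add,
    h.xx i j, sub_self]

/-- For invariant w, bracketing ∑ y_k² with [y_a, [x_b, w]] turns x_b into 2 y_b. The result is
symmetric in a and b, so it cancels in the polar. -/
theorem lie_sum_y_sq_polar (h : WeylRelations x y) {w : R} (hw : ⁅∑ k, y k * y k, w⁆ = 0)
    (i j : ι) : ⁅∑ k, y k * y k, ⁅y j, ⁅x i, w⁆⁆ - ⁅y i, ⁅x j, w⁆⁆⁆ = 0 := by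
  have e (a b : ι) : ⁅∑ k, y k * y k, ⁅y a, ⁅x b, w⁆⁆⁆ = ⁅y a, ⁅y b, w⁆⁆ + ⁅y a, ⁅y b, w⁆⁆ := by
    rw [leibniz_lie, h.lie_sum_y_sq_y, zero_lie, zero_add, leibniz_lie (∑ k, y k * y k) (x b),
      h.lie_sum_y_sq_x, hw, lie_zero, add_zero, two_mul, add_lie, lie_add]
  rw [lie_sub, e, e, h.lie_y_lie_y, sub_self]

theorem lie_sum_x_sq_polar (h : WeylRelations x y) {w : R} (hw : ⁅∑ k, x k * x k, w⁆ = 0)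
    (i j : ι) : ⁅∑ k, x k * x k, ⁅y j, ⁅x i, w⁆⁆ - ⁅y i, ⁅x j, w⁆⁆⁆ = 0 := by
  have e (a b : ι) : ⁅∑ k, x k * x k, ⁅y a, ⁅x b, w⁆⁆⁆ =
      -(⁅x a, ⁅x b, w⁆⁆ + ⁅x a, ⁅x b, w⁆⁆) := by
    rw [leibniz_lie, h.lie_sum_x_sq_y, leibniz_lie (∑ k, x k * x k) (x b),
      h.lie_sum_x_sq_x, hw, lie_zero, zero_lie, add_zero, lie_zero, add_zero, two_mul, neg_lie,
      add_lie]
  rw [lie_sub, e, e, h.lie_x_lie_x, sub_self]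

/-- This is the leading term of the Capelli identity on an invariant, where the raising and lowering
polarizations and the weight vanish modulo lower degree and only the degree survives. -/
theorem capelli_sub_mem_weylFilt [CharZero K] (h : WeylRelations x y) (hBx : ∀ i, ∀ b ∈ B, Commute (x i) b)
    (hBy : ∀ i, ∀ b ∈ B, Commute (y i) b) {d : ℕ} {w : R} (hw : w ∈ weylFilt x y B (d + 1))
    (hyw : ⁅∑ k, y k * y k, w⁆ = 0) (hxw : ⁅∑ k, x k * x k, w⁆ = 0) :
    2 * (∑ i, ∑ j, (x i * y j - x j * y i) * (⁅y j, ⁅x i, w⁆⁆ - ⁅y i, ⁅x j, w⁆⁆)) -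
      (d * (d + 2) : K) • w ∈ weylFilt x y B d := by
  have hlx (i : ι) := (h.lie_mem_weylFilt hBx hBy i d w hw).1
  have hly (i : ι) := (h.lie_mem_weylFilt hBx hBy i d w hw).2
  have half {a : R} (ha : 2 * a ∈ weylFilt x y B d) : a ∈ weylFilt x y B d := by
    have e : a = (2⁻¹ : K) • (2 * a) := by
      rw [two_mul, ← two_smul K, smul_smul, inv_mul_cancel₀ two_ne_zero, one_smul]
    rw [e]
    exact Submodule.smul_mem _ _ ha
  have hyx : ∑ i, ⁅y i, ⁅x i, w⁆⁆ ∈ weylFilt x y B d :=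
    sum_mem fun i _ => (h.lie_mem_weylFilt_self hBx hBy i (hlx i)).2
  obtain ⟨a, ha⟩ : ∃ a, a = ∑ i, x i * ⁅y i, w⁆ := ⟨_, rfl⟩
  obtain ⟨b, hb⟩ : ∃ b, b = ∑ i, y i * ⁅x i, w⁆ := ⟨_, rfl⟩
  obtain ⟨z, hz⟩ : ∃ z, z = ∑ i, x i * ⁅x i, w⁆ := ⟨_, rfl⟩
  have hzmem : z ∈ weylFilt x y B d := by
    refine half ?_
    rw [hz, sum_x_mul_lie_x, hxw, zero_add]
    exact sum_mem fun i _ => (h.lie_mem_weylFilt_self hBx hBy i (hlx i)).1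
  have hab : a + b ∈ weylFilt x y B d := by
    -- The Cartan element is a multiple of the commutator of the two sums of squares, so it also
    -- commutes with w.
    have hH : ⁅∑ i, (x i * y i + y i * x i), w⁆ = 0 := by
      have : ⁅2 * ∑ i, (x i * y i + y i * x i), w⁆ = 0 := by
        rw [← h.lie_sum_sq_sum_sq, lie_lie, hyw, hxw, lie_zero, lie_zero, sub_zero]
      have e : ∑ i, (x i * y i + y i * x i) =
          (2⁻¹ : K) • (2 * ∑ i, (x i * y i + y i * x i)) := by
        rw [two_mul, ← two_smul K, smul_smul, inv_mul_cancel₀ two_ne_zero, one_smul]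
      rw [e, ← lie_skew, lie_smul_eq, ← smul_neg, lie_skew, this, smul_zero]
    refine half ?_
    rw [ha, hb, ← Finset.sum_add_distrib, sum_lie_euler, hH, zero_add]
    exact sum_mem fun i _ => add_mem (h.lie_mem_weylFilt_self hBx hBy i (hlx i)).2
      (h.lie_mem_weylFilt_self hBx hBy i (hly i)).1
  have heuler : a - b - (d : K) • w ∈ weylFilt x y B d := by
    rw [ha, hb, ← Finset.sum_sub_distrib]
    exact h.euler_sub_mem_weylFilt hBx hBy d w hw
  -- From a + b ≡ 0 and a - b ≡ d w modulo lower degree: b ≡ -(d/2) w and a ≡ (d/2) w.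
  obtain ⟨r, hr, hbr⟩ : ∃ r ∈ weylFilt x y B d, (2 : K) • b = r - (d : K) • w :=
    ⟨_, sub_mem hab heuler, by module⟩
  obtain ⟨s, hs, has⟩ : ∃ s ∈ weylFilt x y B d, (2 : K) • a = s + (d : K) • w :=
    ⟨_, add_mem hab heuler, by module⟩
  have hxb : (2 : K) • ∑ i, x i * ⁅y i, b⁆ = ∑ i, x i * ⁅y i, r⁆ - (d : K) • a := by
    simp only [ha, Finset.smul_sum, ← Finset.sum_sub_distrib, ← mul_smul_comm, ← lie_smul_eq,
      hbr, ← mul_sub, ← lie_sub]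
  rw [sum_angMom_mul_polar, h.capelli, ← hz, ← hb]
  -- Modulo lower degree the bracketed expression is (d²/4 + d/2) w, and four times this is d (d +
  -- 2) w. The rest is exhibited as operators of degree zero applied to z, r, s, together with terms
  -- already of lower degree.
  have e : 2 * (2 * ((∑ j, y j * ⁅y j, z⁆) - (∑ i, x i * ⁅y i, b⁆) - b -
      ∑ i, ⁅y i, ⁅x i, w⁆⁆)) - (d * (d + 2) : K) • w =
      (4 : K) • ((∑ j, y j * ⁅y j, z⁆) - ∑ i, ⁅y i, ⁅x i, w⁆⁆) -
        (2 : K) • (∑ i, x i * ⁅y i, r⁆) + (d : K) • s - (2 : K) • r := by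
    have e2 (a : R) : 2 * (2 * a) = (4 : K) • a := by
      rw [two_mul, two_mul]; module
    have e3 : s = (2 : K) • a - (d : K) • w := by rw [has]; module
    have e4 : r = (2 : K) • b + (d : K) • w := by rw [hbr]; module
    have e5 : ∑ i, x i * ⁅y i, r⁆ = (2 : K) • ∑ i, x i * ⁅y i, b⁆ + (d : K) • a := by
      rw [hxb]; module
    rw [e2, e5, e3, e4]
    module
  rw [e]
  refine sub_mem (add_mem (sub_mem (Submodule.smul_mem _ _ (sub_mem (sum_mem fun i _ => ?_) hyx))
    (Submodule.smul_mem _ _ (sum_mem fun i _ => ?_))) (Submodule.smul_mem _ _ hs))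
    (Submodule.smul_mem _ _ hr)
  · exact (h.mul_lie_mem_weylFilt hBx hBy i i hzmem).2
  · exact (h.mul_lie_mem_weylFilt hBx hBy i i hr).1

/-- The first fundamental theorem for `sl(2)`, with coefficients: the elements that commute with
`∑ x_k ^ 2` and `∑ y_k ^ 2` are generated over the coefficients by the angular momenta. -/
theorem mem_of_lie_sum_sq_eq_zero [CharZero K] (h : WeylRelations x y)
    (hBx : ∀ i, ∀ b ∈ B, Commute (x i) b) (hBy : ∀ i, ∀ b ∈ B, Commute (y i) b)
    {M : Submodule K R} (hBM : B ≤ M)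
    (hM : ∀ i j, ∀ m ∈ M, (x i * y j - x j * y i) * m ∈ M) (d : ℕ) :
    ∀ w ∈ weylFilt x y B d, ⁅∑ k, y k * y k, w⁆ = 0 → ⁅∑ k, x k * x k, w⁆ = 0 → w ∈ M := by
  induction d with
  | zero => intro w hw _ _; rw [(Submodule.mem_bot K).mp hw]; exact zero_mem _
  | succ d ih =>
    intro w hw hyw hxw
    -- Level 1 is just B. It is treated apart because the factor d (d + 2) vanishes there.
    rcases Nat.eq_zero_or_pos d with rfl | hd
    · simp only [weylFilt, Submodule.mul_bot, sup_bot_eq] at hw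
      exact hBM hw
    have hterm (i j : ι) :
        (x i * y j - x j * y i) * (⁅y j, ⁅x i, w⁆⁆ - ⁅y i, ⁅x j, w⁆⁆) ∈ M := by
      refine hM i j _ (ih _ ?_ (h.lie_sum_y_sq_polar hyw i j) (h.lie_sum_x_sq_polar hxw i j))
      have hmem (a b : ι) : ⁅y a, ⁅x b, w⁆⁆ ∈ weylFilt x y B d :=
        (h.lie_mem_weylFilt_self hBx hBy a (h.lie_mem_weylFilt hBx hBy b d w hw).1).2
      exact sub_mem (hmem j i) (hmem i j)
    obtain ⟨c, hc⟩ : ∃ c, c = ∑ i, ∑ j,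
        (x i * y j - x j * y i) * (⁅y j, ⁅x i, w⁆⁆ - ⁅y i, ⁅x j, w⁆⁆) := ⟨_, rfl⟩
    have hcM : c ∈ M := hc ▸ sum_mem fun i _ => sum_mem fun j _ => hterm i j
    have hyc : ⁅∑ k, y k * y k, c⁆ = 0 := by
      rw [hc, lie_sum]
      refine Finset.sum_eq_zero fun i _ => ?_
      rw [lie_sum]
      refine Finset.sum_eq_zero fun j _ => ?_
      rw [lie_mul_eq, h.lie_sum_y_sq_angMom, h.lie_sum_y_sq_polar hyw, zero_mul, mul_zero, add_zero]
    have hxc : ⁅∑ k, x k * x k, c⁆ = 0 := by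
      rw [hc, lie_sum]
      refine Finset.sum_eq_zero fun i _ => ?_
      rw [lie_sum]
      refine Finset.sum_eq_zero fun j _ => ?_
      rw [lie_mul_eq, h.lie_sum_x_sq_angMom, h.lie_sum_x_sq_polar hxw, zero_mul, mul_zero, add_zero]
    have hrem := h.capelli_sub_mem_weylFilt hBx hBy hw hyw hxw
    rw [← hc, two_mul] at hrem
    have hremM := ih _ hrem (by rw [lie_sub, lie_add, lie_smul_eq, hyc, hyw]; simp)
      (by rw [lie_sub, lie_add, lie_smul_eq, hxc, hxw]; simp)
    have hne : (d * (d + 2) : K) ≠ 0 := by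
      have : ((d * (d + 2) : ℕ) : K) ≠ 0 := Nat.cast_ne_zero.mpr (by positivity)
      exact_mod_cast this
    have hdw := sub_mem (add_mem hcM hcM) hremM
    rw [sub_sub_cancel] at hdw
    exact (Submodule.smul_mem_iff _ hne).mp hdw

end WeylRelations

end WeylInvariants

/-! ### The even part of a Clifford algebra -/

section EvenClifford

variable {K R ι : Type*} [Field K] [Ring R] [Algebra K R]

/-- The Clifford relations for an orthonormal family. -/
def CliffordRelations [DecidableEq ι] (e : ι → R) : Prop :=
  ∀ i j, e i * e j + e j * e i = if i = j then 2 else 0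

variable (K) in
theorem two_mul_cancel_of_charZero [CharZero K] {a b : R} (hab : 2 * a = 2 * b) : a = b := by
  rw [two_mul, two_mul, ← two_smul K a, ← two_smul K b] at hab
  exact smul_right_injective R (two_ne_zero (α := K)) hab

/-- The even elements of degree less than `2 m` in the elements `e_i`. -/
def cliffFilt (K : Type*) [Field K] [Algebra K R] (e : ι → R) : ℕ → Submodule K R
  | 0 => ⊥
  | m + 1 => 1 ⊔ Submodule.span K (Set.range fun p : ι × ι => e p.1 * e p.2) * cliffFilt K e m

variable {e : ι → R}

theorem mul_mul_mem_cliffFilt (i j : ι) {m : ℕ} {c : R} (hc : c ∈ cliffFilt K e m) :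
    e i * e j * c ∈ cliffFilt K e (m + 1) :=
  Submodule.mem_sup_right
    (Submodule.mul_mem_mul (Submodule.subset_span ⟨(i, j), rfl⟩) hc)

theorem algebraMap_mem_cliffFilt (m : ℕ) (r : K) : algebraMap K R r ∈ cliffFilt K e (m + 1) :=
  Submodule.mem_sup_left (Submodule.algebraMap_mem r)

theorem cliffFilt_le_succ (m : ℕ) : cliffFilt K e m ≤ cliffFilt K e (m + 1) := by
  induction m with
  | zero => exact bot_le
  | succ m ih => exact sup_le_sup_left (mul_le_mul_right ih _) _

theorem cliffFilt_mono : Monotone (cliffFilt K e) := monotone_nat_of_le_succ cliffFilt_le_succ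

theorem cliffFilt_succ_induction {m : ℕ} {p : R → Prop} (halg : ∀ r : K, p (algebraMap K R r))
    (hmul : ∀ i j, ∀ c ∈ cliffFilt K e m, p (e i * e j * c))
    (hadd : ∀ a b, p a → p b → p (a + b)) (hsmul : ∀ (r : K) a, p a → p (r • a)) :
    ∀ c ∈ cliffFilt K e (m + 1), p c := by
  let S : Submodule K R :=
    { carrier := {a | p a}
      add_mem' := fun ha hb => hadd _ _ ha hb
      zero_mem' := by simpa using halg 0
      smul_mem' := fun c _ ha => hsmul c _ ha }
  have : cliffFilt K e (m + 1) ≤ S := by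
    refine sup_le (fun a ha => ?_) (Submodule.mul_le.mpr fun g hg w hw => ?_)
    · obtain ⟨r, rfl⟩ := Submodule.mem_one.mp ha
      exact halg r
    · induction hg using Submodule.span_induction with
      | mem g hg => obtain ⟨⟨i, j⟩, rfl⟩ := hg; exact hmul i j w hw
      | zero => rw [zero_mul]; exact S.zero_mem
      | add a b _ _ ha hb => rw [add_mul]; exact S.add_mem ha hb
      | smul c a _ ha => rw [smul_mul_assoc]; exact S.smul_mem c ha
  exact this

theorem lie_algebraMap_eq_zero (a : R) (r : K) : ⁅a, algebraMap K R r⁆ = 0 :=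
  Commute.lie_eq (Algebra.commutes r a).symm

theorem commute_of_mem_cliffFilt {a : R} (ha : ∀ i, Commute a (e i)) (m : ℕ) :
    ∀ c ∈ cliffFilt K e m, Commute a c := by
  induction m with
  | zero => intro c hc; rw [(Submodule.mem_bot K).mp hc]; exact Commute.zero_right a
  | succ m ih =>
    exact cliffFilt_succ_induction (fun r => (Algebra.commutes r a).symm)
      (fun i j c hc => ((ha i).mul_right (ha j)).mul_right (ih c hc))
      (fun _ _ => Commute.add_right) (fun r _ h => h.smul_right r)

theorem mul_mem_cliffFilt (i j : ι) (m : ℕ) :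
    ∀ c ∈ cliffFilt K e m, c * (e i * e j) ∈ cliffFilt K e (m + 1) := by
  induction m with
  | zero => intro c hc; rw [(Submodule.mem_bot K).mp hc, zero_mul]; exact zero_mem _
  | succ m ih =>
    refine cliffFilt_succ_induction (fun r => ?_) (fun k l c hc => ?_) (fun a b ha hb => ?_)
      (fun r a ha => ?_)
    · rw [Algebra.commutes]
      exact mul_mul_mem_cliffFilt i j (algebraMap_mem_cliffFilt m r)
    · rw [mul_assoc (e k * e l)]
      exact mul_mul_mem_cliffFilt k l (ih c hc)
    · rw [add_mul]; exact add_mem ha hb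
    · rw [smul_mul_assoc]; exact Submodule.smul_mem _ _ ha

theorem ite_mul_mem (p : Prop) [Decidable p] {S : Submodule K R} {c : R} (hc : c ∈ S) :
    (if p then (2 : R) else 0) * c ∈ S := by
  split_ifs
  · rw [two_mul]; exact add_mem hc hc
  · rw [zero_mul]; exact zero_mem _

namespace CliffordRelations

variable [DecidableEq ι]

theorem mul_comm_eq (h : CliffordRelations e) (i j : ι) :
    e i * e j = (if i = j then 2 else 0) - e j * e i := by
  rw [← h i j, add_sub_cancel_right]

theorem lie_mul_mul (h : CliffordRelations e) (k i j : ι) (c : R) :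
    ⁅e k, e i * e j * c⁆ = (if k = i then 2 else 0) * (e j * c) -
      (if k = j then 2 else 0) * (e i * c) + e i * e j * ⁅e k, c⁆ := by
  have hc : (if k = j then (2 : R) else 0) * (e i * c) =
      e i * (if k = j then (2 : R) else 0) * c := by
    split_ifs <;> noncomm_ring
  rw [hc, ← h k i, ← h k j, Ring.lie_def, Ring.lie_def]
  noncomm_ring

/-- On even elements the commutator with e_k is a contraction: it removes one generator, and e_l
puts one back. -/
theorem mul_lie_mem_cliffFilt (h : CliffordRelations e) (k : ι) (m : ℕ) :
    ∀ c ∈ cliffFilt K e m, ∀ l, e l * ⁅e k, c⁆ ∈ cliffFilt K e m := by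
  induction m with
  | zero => intro c hc; rw [(Submodule.mem_bot K).mp hc]; simp
  | succ m ih =>
    refine cliffFilt_succ_induction (fun r l => ?_) (fun i j c hc l => ?_) (fun a b ha hb l => ?_)
      (fun r a ha l => ?_)
    · rw [lie_algebraMap_eq_zero, mul_zero]; exact zero_mem _
    · have e1 : e l * ⁅e k, e i * e j * c⁆ = (if k = i then 2 else 0) * (e l * e j * c) -
          (if k = j then 2 else 0) * (e l * e i * c) + e l * e i * (e j * ⁅e k, c⁆) := by
        rw [h.lie_mul_mul]
        split_ifs <;> noncomm_ring
      rw [e1]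
      exact add_mem (sub_mem (ite_mul_mem _ (mul_mul_mem_cliffFilt l j hc))
        (ite_mul_mem _ (mul_mul_mem_cliffFilt l i hc))) (mul_mul_mem_cliffFilt l i (ih c hc j))
    · rw [lie_add, mul_add]; exact add_mem (ha l) (hb l)
    · rw [lie_smul_eq, mul_smul_comm]; exact Submodule.smul_mem _ _ (ha l)

theorem antilie_lie_mul_mul (h : CliffordRelations e) (k l i j : ι) (c : R) :
    e k * ⁅e l, e i * e j * c⁆ + ⁅e l, e i * e j * c⁆ * e k =
      (if l = i then 2 else 0) * ((if k = j then 2 else 0) * c - e j * ⁅e k, c⁆) -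
      (if l = j then 2 else 0) * ((if k = i then 2 else 0) * c - e i * ⁅e k, c⁆) +
      ((if k = i then 2 else 0) * (e j * ⁅e l, c⁆) - (if k = j then 2 else 0) * (e i * ⁅e l, c⁆)) +
      e i * e j * (e k * ⁅e l, c⁆ + ⁅e l, c⁆ * e k) := by
  have h1 (a : ι) : e k * (e a * c) + e a * c * e k =
      (if k = a then 2 else 0) * c - e a * ⁅e k, c⁆ := by
    rw [← h k a, Ring.lie_def]; noncomm_ring
  have h2 : e k * (e i * e j * ⁅e l, c⁆) + e i * e j * ⁅e l, c⁆ * e k =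
      ((if k = i then 2 else 0) * (e j * ⁅e l, c⁆) - (if k = j then 2 else 0) * (e i * ⁅e l, c⁆)) +
      e i * e j * (e k * ⁅e l, c⁆ + ⁅e l, c⁆ * e k) := by
    have := h.lie_mul_mul k i j ⁅e l, c⁆
    rw [Ring.lie_def (e k), Ring.lie_def (e k) ⁅e l, c⁆, sub_eq_iff_eq_add] at this
    rw [this]
    noncomm_ring
  rw [h.lie_mul_mul l, ← h1, ← h1, add_assoc _ _ (e i * e j * _), ← h2]
  split_ifs <;> noncomm_ring

/-- The commutator contracts an even element to an odd one, and the anticommutator contracts that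
again. Two generators disappear, which is one step of the filtration. -/
theorem antilie_lie_mem_cliffFilt (h : CliffordRelations e) (k l : ι) (m : ℕ) :
    ∀ c ∈ cliffFilt K e (m + 1), e k * ⁅e l, c⁆ + ⁅e l, c⁆ * e k ∈ cliffFilt K e m := by
  induction m with
  | zero =>
    refine cliffFilt_succ_induction (fun r => ?_) (fun i j c hc => ?_) (fun a b ha hb => ?_)
      (fun r a ha => ?_)
    · rw [lie_algebraMap_eq_zero, mul_zero, zero_mul, add_zero]; exact zero_mem _
    · rw [(Submodule.mem_bot K).mp hc]; simp
    · rw [lie_add, mul_add, add_mul, add_add_add_comm]; exact add_mem ha hb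
    · rw [lie_smul_eq, mul_smul_comm, smul_mul_assoc, ← smul_add]; exact Submodule.smul_mem _ _ ha
  | succ m ih =>
    refine cliffFilt_succ_induction (fun r => ?_) (fun i j c hc => ?_) (fun a b ha hb => ?_)
      (fun r a ha => ?_)
    · rw [lie_algebraMap_eq_zero, mul_zero, zero_mul, add_zero]; exact zero_mem _
    · have hl := h.mul_lie_mem_cliffFilt l _ c hc
      have hk := h.mul_lie_mem_cliffFilt k _ c hc
      rw [h.antilie_lie_mul_mul]
      refine add_mem (add_mem (sub_mem ?_ ?_) (sub_mem ?_ ?_)) ?_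
      · exact ite_mul_mem _ (sub_mem (ite_mul_mem _ hc) (hk j))
      · exact ite_mul_mem _ (sub_mem (ite_mul_mem _ hc) (hk i))
      · exact ite_mul_mem _ (hl j)
      · exact ite_mul_mem _ (hl i)
      · exact mul_mul_mem_cliffFilt i j (ih c hc)
    · rw [lie_add, mul_add, add_mul, add_add_add_comm]; exact add_mem ha hb
    · rw [lie_smul_eq, mul_smul_comm, smul_mul_assoc, ← smul_add]; exact Submodule.smul_mem _ _ ha

/-- Contractions anticommute, because e_k e_l + e_l e_k is a scalar and hence central. -/
theorem antilie_lie_skew (h : CliffordRelations e) (k l : ι) (c : R) :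
    e k * ⁅e l, c⁆ + ⁅e l, c⁆ * e k = -(e l * ⁅e k, c⁆ + ⁅e k, c⁆ * e l) := by
  have hc : (e k * e l + e l * e k) * c = c * (e k * e l + e l * e k) := by
    rw [h k l]; split_ifs <;> noncomm_ring
  rw [← sub_eq_zero] at hc ⊢
  rw [← hc]
  simp only [Ring.lie_def]
  noncomm_ring

theorem antilie_lie_self [CharZero K] (h : CliffordRelations e) (k : ι) (c : R) :
    e k * ⁅e k, c⁆ + ⁅e k, c⁆ * e k = 0 := by
  refine two_mul_cancel_of_charZero K ?_
  rw [mul_zero, two_mul]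
  nth_rw 1 [h.antilie_lie_skew k k c]
  exact neg_add_cancel _

variable [Fintype ι]

/-! ### The number operator of the Clifford algebra -/

theorem number_mul_mul (h : CliffordRelations e) (i j : ι) (c : R) :
    ∑ k, e k * ⁅e k, e i * e j * c⁆ = 4 * (e i * e j * c) - 2 * ((if i = j then 2 else 0) * c) +
      e i * e j * ∑ k, e k * ⁅e k, c⁆ + 2 * (e j * ⁅e i, c⁆) - 2 * (e i * ⁅e j, c⁆) := by
  have key (k : ι) : e k * ⁅e k, e i * e j * c⁆ = (if k = i then 2 * (e i * e j * c) else 0) -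
      (if k = j then 2 * (e j * e i * c) else 0) + e i * e j * (e k * ⁅e k, c⁆) +
      (if k = i then 2 * (e j * ⁅e i, c⁆) else 0) - (if k = j then 2 * (e i * ⁅e j, c⁆) else 0) := by
    have h3 : e k * (e i * e j) = (if k = i then 2 else 0) * e j -
        (if k = j then 2 else 0) * e i + e i * e j * e k := by
      have hc : (if k = j then (2 : R) else 0) * e i = e i * (if k = j then (2 : R) else 0) := by
        split_ifs <;> noncomm_ring
      rw [hc, ← h k i, ← h k j]
      noncomm_ring
    rw [h.lie_mul_mul, mul_add, ← mul_assoc (e k) (e i * e j), h3]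
    split_ifs with h1 h2 h2
    · subst h1; subst h2; noncomm_ring
    · subst h1; noncomm_ring
    · subst h2; noncomm_ring
    · noncomm_ring
  rw [Finset.sum_congr rfl fun k _ => key k]
  simp only [Finset.sum_add_distrib, Finset.sum_sub_distrib, ← Finset.mul_sum, Finset.sum_ite_eq',
    Finset.mem_univ, if_true]
  rw [h.mul_comm_eq j i]
  simp only [eq_comm (a := j)]
  noncomm_ring

/-- On an even product of distinct generators, e_k [e_k, ·] is 2 if e_k occurs and 0 otherwise. The
top degree in level m + 1 is 2m, which gives the eigenvalue 4m. -/
theorem number_sub_mem_cliffFilt (h : CliffordRelations e) (m : ℕ) :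
    ∀ c ∈ cliffFilt K e (m + 1),
      ∑ k, e k * ⁅e k, c⁆ - (4 * m : K) • c ∈ cliffFilt K e m := by
  have hadd (m : ℕ) (a b : R) (ha : ∑ k, e k * ⁅e k, a⁆ - (4 * m : K) • a ∈ cliffFilt K e m)
      (hb : ∑ k, e k * ⁅e k, b⁆ - (4 * m : K) • b ∈ cliffFilt K e m) :
      ∑ k, e k * ⁅e k, a + b⁆ - (4 * m : K) • (a + b) ∈ cliffFilt K e m := by
    have := add_mem ha hb
    simpa only [lie_add, mul_add, Finset.sum_add_distrib, smul_add, sub_add_sub_comm] using this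
  have hsmul (m : ℕ) (r : K) (a : R)
      (ha : ∑ k, e k * ⁅e k, a⁆ - (4 * m : K) • a ∈ cliffFilt K e m) :
      ∑ k, e k * ⁅e k, r • a⁆ - (4 * m : K) • (r • a) ∈ cliffFilt K e m := by
    have := Submodule.smul_mem _ r ha
    rw [smul_sub, smul_comm r, Finset.smul_sum] at this
    simpa only [lie_smul_eq, mul_smul_comm] using this
  induction m with
  | zero =>
    refine cliffFilt_succ_induction (fun r => ?_) (fun i j c hc => ?_) (hadd 0) (hsmul 0)
    · simp [lie_algebraMap_eq_zero]
    · rw [(Submodule.mem_bot K).mp hc]; simp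
  | succ m ih =>
    refine cliffFilt_succ_induction (fun r => ?_) (fun i j c hc => ?_) (hadd _) (hsmul _)
    · simp only [lie_algebraMap_eq_zero, mul_zero, Finset.sum_const_zero, zero_sub]
      exact neg_mem (Submodule.smul_mem _ _ (algebraMap_mem_cliffFilt m r))
    · have two {a : R} (ha : a ∈ cliffFilt K e (m + 1)) : 2 * a ∈ cliffFilt K e (m + 1) := by
        rw [two_mul]; exact add_mem ha ha
      have e1 : ∑ k, e k * ⁅e k, e i * e j * c⁆ - (4 * (m + 1 : ℕ) : K) • (e i * e j * c) =
          e i * e j * (∑ k, e k * ⁅e k, c⁆ - (4 * m : K) • c) -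
            2 * ((if i = j then 2 else 0) * c) + 2 * (e j * ⁅e i, c⁆) - 2 * (e i * ⁅e j, c⁆) := by
        have e2 : (4 * (m + 1 : ℕ) : K) • (e i * e j * c) =
            4 * (e i * e j * c) + e i * e j * ((4 * m : K) • c) := by
          have e3 : 4 * (e i * e j * c) = (4 : K) • (e i * e j * c) := by
            rw [ofNat_smul_eq_nsmul, nsmul_eq_mul]; norm_cast
          rw [mul_smul_comm, e3]; push_cast; module
        rw [h.number_mul_mul, e2]
        noncomm_ring
      rw [e1]
      exact sub_mem (add_mem (sub_mem (mul_mul_mem_cliffFilt i j (ih c hc))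
        (two (ite_mul_mem _ hc))) (two (h.mul_lie_mem_cliffFilt i _ c hc j)))
        (two (h.mul_lie_mem_cliffFilt j _ c hc i))

/-- The square of the number operator differs from twice the operator by a sum of double
contractions. This is what lets the Clifford halves of the O_jk be traded for a polynomial in the
number operator. -/
theorem number_number [CharZero K] (h : CliffordRelations e) (c : R) :
    ∑ k, e k * ⁅e k, ∑ l, e l * ⁅e l, c⁆⁆ = 2 * ∑ k, e k * ⁅e k, c⁆ +
      ∑ l, ∑ k, e l * e k * (e k * ⁅e l, c⁆ + ⁅e l, c⁆ * e k) := by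
  have key (k l : ι) : e k * ⁅e k, e l * ⁅e l, c⁆⁆ = (if k = l then 2 * (e k * ⁅e k, c⁆) else 0) +
      e l * e k * (e k * ⁅e l, c⁆ + ⁅e l, c⁆ * e k) := by
    have h1 : e k * ⁅e k, e l * ⁅e l, c⁆⁆ = e k * ((e k * e l + e l * e k) * ⁅e l, c⁆) -
        (e k * e l + e l * e k) * (e k * ⁅e l, c⁆ + ⁅e l, c⁆ * e k) +
        e l * e k * (e k * ⁅e l, c⁆ + ⁅e l, c⁆ * e k) := by
      rw [Ring.lie_def (e k)]; noncomm_ring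
    rw [h1, h k l]
    split_ifs with hkl
    · subst hkl
      rw [h.antilie_lie_self (K := K)]
      noncomm_ring
    · simp
  simp only [lie_sum, Finset.mul_sum]
  rw [Finset.sum_comm]
  simp only [key, Finset.sum_add_distrib, Finset.sum_ite_eq', Finset.mem_univ, if_true]

end CliffordRelations

end EvenClifford

/-! ### Even elements that commute with the Dirac operator and its dual -/

section DiracInvariants

variable {K R ι : Type*} [Field K] [Ring R] [Algebra K R]

/-- The anticommutator with the first element of the commutator with the second. -/
def doubleBracket (K : Type*) [Field K] [Algebra K R] (D D' : R) : R →ₗ[K] R :=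
  (LinearMap.mulLeft K D + LinearMap.mulRight K D) ∘ₗ
    (LinearMap.mulLeft K D' - LinearMap.mulRight K D')

theorem doubleBracket_apply (D D' z : R) :
    doubleBracket K D D' z = D * ⁅D', z⁆ + ⁅D', z⁆ * D := by
  simp [doubleBracket, Ring.lie_def]

theorem doubleBracket_mul_right {D D' a : R} (h : Commute a D) (h' : Commute a D') (z : R) :
    doubleBracket K D D' (z * a) = doubleBracket K D D' z * a := by
  rw [doubleBracket_apply, doubleBracket_apply, lie_mul_eq, h'.symm.lie_eq, mul_zero, add_zero,
    mul_assoc _ a, h.eq]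
  noncomm_ring

theorem doubleBracket_mul_left {D D' a : R} (h : Commute a D) (h' : Commute a D') (z : R) :
    doubleBracket K D D' (a * z) = a * doubleBracket K D D' z := by
  rw [doubleBracket_apply, doubleBracket_apply, lie_mul_eq, h'.symm.lie_eq, zero_mul, zero_add,
    ← mul_assoc D a, ← h.eq]
  noncomm_ring

theorem doubleBracket_of_commute {D D' w : R} (h' : Commute w D') :
    doubleBracket K D D' w = 0 := by
  rw [doubleBracket_apply, h'.symm.lie_eq, mul_zero, zero_mul, add_zero]

/-- Put u = [D', z] and H = D D' + D' D. Since D'² commutes with z, D' u = -u D', and therefore [D',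
D u + u D] = [H, u]. The first hypothesis says [H, D'] = 2 D' and H commutes with z, so [H, u] = 2
u. -/
theorem doubleBracket_doubleBracket {D D' z : R} (hD : ⁅D, D' * D'⁆ = 2 * D')
    (h1 : ⁅D' * D', z⁆ = 0) (h2 : ⁅D * D' + D' * D, z⁆ = 0) :
    doubleBracket K D D' (doubleBracket K D D' z) = (2 : K) • doubleBracket K D D' z := by
  have key : ⁅D', D * ⁅D', z⁆ + ⁅D', z⁆ * D⁆ = 2 * ⁅D', z⁆ := by
    have e : ⁅D', D * ⁅D', z⁆ + ⁅D', z⁆ * D⁆ = 2 * ⁅D', z⁆ + (⁅D, D' * D'⁆ - 2 * D') * z -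
        z * (⁅D, D' * D'⁆ - 2 * D') - D * ⁅D' * D', z⁆ + ⁅D' * D', z⁆ * D +
        ⁅D * D' + D' * D, z⁆ * (-D') + D' * ⁅D * D' + D' * D, z⁆ := by
      simp only [Ring.lie_def]
      noncomm_ring
    rw [e, hD, h1, h2]
    noncomm_ring
  rw [doubleBracket_apply, doubleBracket_apply, key, two_smul]
  noncomm_ring

variable [DecidableEq ι] {x y e : ι → R}

/-- The relations of the Weyl-Clifford algebra. -/
structure WeylCliffRelations (x y e : ι → R) : Prop where
  weyl : WeylRelations x y
  cliff : CliffordRelations e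
  ex : ∀ i j, Commute (e i) (x j)
  ey : ∀ i j, Commute (e i) (y j)

theorem CliffordRelations.mul_self [CharZero K] (h : CliffordRelations e) (i : ι) :
    e i * e i = 1 := by
  refine two_mul_cancel_of_charZero K ?_
  rw [two_mul, h i i, if_pos rfl, mul_one]

variable [Fintype ι]

theorem CliffordRelations.sum_symm_mul [CharZero K] (h : CliffordRelations e) (s : ι → ι → R)
    (hs : ∀ i j, s i j = s j i) : ∑ i, ∑ j, s i j * (e i * e j) = ∑ i, s i i := by
  refine two_mul_cancel_of_charZero K ?_
  rw [two_mul]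
  nth_rw 2 [Finset.sum_comm]
  simp only [← Finset.sum_add_distrib, Finset.mul_sum]
  refine Finset.sum_congr rfl fun i _ => ?_
  have key (j : ι) : s i j * (e i * e j) + s j i * (e j * e i) =
      if i = j then 2 * s i i else 0 := by
    rw [hs j i, ← mul_add, h i j]
    split_ifs with hij
    · subst hij; noncomm_ring
    · simp
  simp only [key, Finset.sum_ite_eq, Finset.mem_univ, if_true]

namespace WeylCliffRelations

theorem dirac_mul_dirac [CharZero K] (h : WeylCliffRelations x y e) :
    (∑ i, y i * e i) * (∑ i, y i * e i) = ∑ i, y i * y i := by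
  rw [← h.cliff.sum_symm_mul (K := K) (fun i j => y i * y j) h.weyl.yy, Finset.sum_mul_sum]
  refine Finset.sum_congr rfl fun i _ => Finset.sum_congr rfl fun j _ => ?_
  rw [mul_assoc, ← mul_assoc (e i), (h.ey i j).eq]
  noncomm_ring

theorem diracDual_mul_diracDual [CharZero K] (h : WeylCliffRelations x y e) :
    (∑ i, x i * e i) * (∑ i, x i * e i) = ∑ i, x i * x i := by
  rw [← h.cliff.sum_symm_mul (K := K) (fun i j => x i * x j) h.weyl.xx, Finset.sum_mul_sum]
  refine Finset.sum_congr rfl fun i _ => Finset.sum_congr rfl fun j _ => ?_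
  rw [mul_assoc, ← mul_assoc (e i), (h.ex i j).eq]
  noncomm_ring

theorem dirac_mul_diracDual_add [CharZero K] (h : WeylCliffRelations x y e) :
    (∑ i, y i * e i) * (∑ i, x i * e i) + (∑ i, x i * e i) * (∑ i, y i * e i) =
      ∑ i, (2 * (x i * y i) + 1) := by
  rw [Finset.sum_mul_sum, Finset.sum_mul_sum]
  nth_rw 2 [Finset.sum_comm]
  simp only [← Finset.sum_add_distrib]
  refine Finset.sum_congr rfl fun i _ => ?_
  have key (j : ι) : y i * e i * (x j * e j) + x j * e j * (y i * e i) =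
      if i = j then 2 * (x i * y i) + 1 else 0 := by
    have e1 : y i * e i * (x j * e j) + x j * e j * (y i * e i) =
        y i * x j * (e i * e j) + x j * y i * (e j * e i) := by
      rw [mul_assoc, ← mul_assoc (e i), (h.ex i j).eq, mul_assoc (x j) (e j), ← mul_assoc (e j),
        (h.ey j i).eq]
      noncomm_ring
    rw [e1, h.weyl.yx]
    split_ifs with hij
    · subst hij; rw [h.cliff.mul_self (K := K)]; noncomm_ring
    · have := h.cliff i j
      rw [if_neg hij] at this
      rw [add_zero, ← mul_add, this, mul_zero]
  simp only [key, Finset.sum_ite_eq, Finset.mem_univ, if_true]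

theorem lie_dirac_diracDual_sq [CharZero K] (h : WeylCliffRelations x y e) :
    ⁅∑ i, y i * e i, (∑ i, x i * e i) * (∑ i, x i * e i)⁆ = 2 * ∑ i, x i * e i := by
  rw [h.diracDual_mul_diracDual (K := K), ← lie_skew, lie_sum, ← Finset.sum_neg_distrib,
    Finset.mul_sum]
  refine Finset.sum_congr rfl fun i _ => ?_
  have hc : Commute (∑ k, x k * x k) (e i) :=
    Commute.sum_left _ _ _ fun k _ => ((h.ex i k).symm.mul_left (h.ex i k).symm)
  rw [lie_mul_eq, h.weyl.lie_sum_x_sq_y, hc.lie_eq]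
  noncomm_ring

/-- The number operator is the price of reordering y_k x_j; what remains has only double
contractions of c. -/
theorem doubleBracket_eq (h : WeylCliffRelations x y e) {c : R} (hx : ∀ i, Commute (x i) c)
    (hy : ∀ i, Commute (y i) c) :
    doubleBracket K (∑ i, y i * e i) (∑ i, x i * e i) c = ∑ i, e i * ⁅e i, c⁆ +
      ∑ j, ∑ k, x j * y k * (e k * ⁅e j, c⁆ + ⁅e j, c⁆ * e k) := by
  have hu : ⁅∑ i, x i * e i, c⁆ = ∑ i, x i * ⁅e i, c⁆ := by
    rw [sum_lie]
    refine Finset.sum_congr rfl fun i _ => ?_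
    rw [← lie_skew, lie_mul_eq, (hx i).symm.lie_eq, zero_mul, zero_add, ← mul_neg, lie_skew]
  rw [doubleBracket_apply, hu, Finset.sum_mul_sum, Finset.sum_mul_sum, Finset.sum_comm,
    ← Finset.sum_add_distrib, ← Finset.sum_add_distrib]
  refine Finset.sum_congr rfl fun j _ => ?_
  have key (k : ι) : y k * e k * (x j * ⁅e j, c⁆) + x j * ⁅e j, c⁆ * (y k * e k) =
      (if k = j then e j * ⁅e j, c⁆ else 0) +
        x j * y k * (e k * ⁅e j, c⁆ + ⁅e j, c⁆ * e k) := by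
    have hv : Commute ⁅e j, c⁆ (y k) := by
      rw [Ring.lie_def]
      exact ((h.ey j k).mul_left (hy k).symm).sub_left ((hy k).symm.mul_left (h.ey j k))
    have e1 : y k * e k * (x j * ⁅e j, c⁆) + x j * ⁅e j, c⁆ * (y k * e k) =
        y k * x j * (e k * ⁅e j, c⁆) + x j * y k * (⁅e j, c⁆ * e k) := by
      rw [mul_assoc, ← mul_assoc (e k), (h.ex k j).eq, mul_assoc (x j) ⁅e j, c⁆,
        ← mul_assoc ⁅e j, c⁆, hv.eq]
      noncomm_ring
    rw [e1, h.weyl.yx]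
    split_ifs with hkj
    · subst hkj; noncomm_ring
    · noncomm_ring
  rw [← Finset.sum_add_distrib, Finset.sum_congr rfl fun k _ => key k, Finset.sum_add_distrib]
  simp only [Finset.sum_ite_eq', Finset.mem_univ, if_true]

/-- Antisymmetry of the double contraction turns x_j y_k into half an angular momentum. Completing
it to a two-index symmetry adds e_j e_k / 2, whose contribution is N² - 2N by `number_number`; hence
4N + 2N - N². -/
theorem four_smul_doubleBracket [CharZero K] (h : WeylCliffRelations x y e) {c : R}
    (hx : ∀ i, Commute (x i) c) (hy : ∀ i, Commute (y i) c) :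
    (4 : K) • doubleBracket K (∑ i, y i * e i) (∑ i, x i * e i) c =
      (6 : K) • ∑ i, e i * ⁅e i, c⁆ - ∑ i, e i * ⁅e i, ∑ j, e j * ⁅e j, c⁆⁆ +
      (2 : K) • ∑ j, ∑ k, (x j * y k - x k * y j + (2⁻¹ : K) • (e j * e k)) *
        (e k * ⁅e j, c⁆ + ⁅e j, c⁆ * e k) := by
  have e1 : (2 : K) • ∑ j, ∑ k, x j * y k * (e k * ⁅e j, c⁆ + ⁅e j, c⁆ * e k) =
      ∑ j, ∑ k, (x j * y k - x k * y j) * (e k * ⁅e j, c⁆ + ⁅e j, c⁆ * e k) := by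
    rw [two_smul]
    nth_rw 2 [Finset.sum_comm]
    simp only [← Finset.sum_add_distrib]
    refine Finset.sum_congr rfl fun j _ => Finset.sum_congr rfl fun k _ => ?_
    rw [h.cliff.antilie_lie_skew j k]
    noncomm_ring
  have e2 : (2 : K) • ∑ j, ∑ k, (x j * y k - x k * y j + (2⁻¹ : K) • (e j * e k)) *
        (e k * ⁅e j, c⁆ + ⁅e j, c⁆ * e k) =
      (2 : K) • ∑ j, ∑ k, (x j * y k - x k * y j) * (e k * ⁅e j, c⁆ + ⁅e j, c⁆ * e k) +
      ∑ j, ∑ k, e j * e k * (e k * ⁅e j, c⁆ + ⁅e j, c⁆ * e k) := by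
    simp only [Finset.smul_sum, ← Finset.sum_add_distrib]
    refine Finset.sum_congr rfl fun j _ => Finset.sum_congr rfl fun k _ => ?_
    rw [add_mul, smul_add, smul_mul_assoc, smul_smul, mul_inv_cancel₀ two_ne_zero, one_smul]
  rw [h.doubleBracket_eq hx hy, h.cliff.number_number (K := K), e2, ← e1, two_mul]
  module

variable {A : Subalgebra K R}

/-- The operator P = 2 - T is left linear over A and kills T c. Applied to the formula for 4T c it
expresses a multiple of P c through P of elements of lower degree and products of these with members
of A. -/
theorem two_smul_sub_doubleBracket_mem [CharZero K] (h : WeylCliffRelations x y e)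
    (hA : ∀ i j, i ≠ j → x i * y j - x j * y i + (2⁻¹ : K) • (e i * e j) ∈ A)
    (hAD : ∀ a ∈ A, Commute a (∑ i, y i * e i)) (hAD' : ∀ a ∈ A, Commute a (∑ i, x i * e i))
    (m : ℕ) : ∀ c ∈ cliffFilt K e m,
      (2 : K) • c - doubleBracket K (∑ i, y i * e i) (∑ i, x i * e i) c ∈ A := by
  obtain ⟨D, hD⟩ : ∃ D, D = ∑ i, y i * e i := ⟨_, rfl⟩
  obtain ⟨D', hD'⟩ : ∃ D', D' = ∑ i, x i * e i := ⟨_, rfl⟩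
  obtain ⟨P, hP⟩ : ∃ P : R →ₗ[K] R, ∀ z, P z = (2 : K) • z - doubleBracket K D D' z :=
    ⟨(2 : K) • LinearMap.id - doubleBracket K D D', fun z => by simp⟩
  rw [← hD] at hAD ⊢
  rw [← hD'] at hAD' ⊢
  simp only [← hP]
  have hPl {a : R} (ha : a ∈ A) (z : R) : P (a * z) = a * P z := by
    rw [hP, hP, doubleBracket_mul_left (hAD a ha) (hAD' a ha), mul_sub, mul_smul_comm]
  induction m with
  | zero => intro c hc; rw [(Submodule.mem_bot K).mp hc, map_zero]; exact zero_mem _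
  | succ m ih =>
    intro c hc
    -- Level 1 consists of scalars, where T vanishes; the coefficient found below is zero for m = 0.
    rcases Nat.eq_zero_or_pos m with rfl | hm
    · simp only [cliffFilt, Submodule.mul_bot, sup_bot_eq, Submodule.mem_one] at hc
      obtain ⟨r, rfl⟩ := hc
      rw [hP, doubleBracket_of_commute (Algebra.commutes r D'), sub_zero]
      exact A.smul_mem (A.algebraMap_mem r) _
    have hcx (i : ι) : Commute (x i) c :=
      commute_of_mem_cliffFilt (fun j => (h.ex j i).symm) _ c hc
    have hcy (i : ι) : Commute (y i) c :=
      commute_of_mem_cliffFilt (fun j => (h.ey j i).symm) _ c hc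
    have hPT : P (doubleBracket K D D' c) = 0 := by
      rw [hP, doubleBracket_doubleBracket, sub_self]
      · rw [hD, hD', h.lie_dirac_diracDual_sq (K := K)]
      · rw [hD', h.diracDual_mul_diracDual (K := K)]
        exact (Commute.sum_left _ _ _ fun k _ => (hcx k).mul_left (hcx k)).lie_eq
      · rw [hD, hD', h.dirac_mul_diracDual_add (K := K)]
        exact (Commute.sum_left _ _ _ fun k _ => (Commute.add_left ((Commute.ofNat_left 2 c).mul_left
          ((hcx k).mul_left (hcy k))) (Commute.one_left c))).lie_eq
    have hT := h.four_smul_doubleBracket (K := K) hcx hcy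
    rw [← hD, ← hD'] at hT
    obtain ⟨r, hr, hnr⟩ : ∃ r ∈ cliffFilt K e m, ∑ k, e k * ⁅e k, c⁆ = (4 * m : K) • c + r :=
      ⟨_, h.cliff.number_sub_mem_cliffFilt m c hc, by abel⟩
    have hnn : ∑ k, e k * ⁅e k, ∑ l, e l * ⁅e l, c⁆⁆ =
        (4 * m : K) • ((4 * m : K) • c + r) + ∑ k, e k * ⁅e k, r⁆ := by
      rw [hnr]
      simp only [lie_add, lie_smul_eq, mul_add, mul_smul_comm, Finset.sum_add_distrib,
        ← Finset.smul_sum, hnr]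
    have hnrmem : ∑ k, e k * ⁅e k, r⁆ ∈ cliffFilt K e m :=
      sum_mem fun k _ => h.cliff.mul_lie_mem_cliffFilt k m r hr k
    rw [hnn, hnr] at hT
    have hterm (j k : ι) : P ((x j * y k - x k * y j + (2⁻¹ : K) • (e j * e k)) *
        (e k * ⁅e j, c⁆ + ⁅e j, c⁆ * e k)) ∈ A := by
      -- The hypothesis on A says nothing about equal indices, but there the double contraction is
      -- zero.
      by_cases hjk : j = k
      · subst hjk
        rw [h.cliff.antilie_lie_self (K := K), mul_zero, map_zero]; exact zero_mem _
      · rw [hPl (hA j k hjk)]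
        exact A.mul_mem (hA j k hjk) (ih _ (h.cliff.antilie_lie_mem_cliffFilt k j m c hc))
    have hsum : (2 : K) • P (∑ j, ∑ k, (x j * y k - x k * y j + (2⁻¹ : K) • (e j * e k)) *
        (e k * ⁅e j, c⁆ + ⁅e j, c⁆ * e k)) ∈ A := by
      simp only [map_sum]
      exact A.smul_mem (sum_mem fun j _ => sum_mem fun k _ => hterm j k) _
    have hPc := congrArg P hT
    rw [map_smul, hPT, smul_zero, map_add, map_smul P 2] at hPc
    -- The coefficient is 6N - N² at N = 4m. It is nonzero for m > 0 because 3 - 2m is odd.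
    have hfin : (8 * m * (3 - 2 * m) : K) • P c ∈ A := by
      have e1 : (8 * m * (3 - 2 * m) : K) • c = ((6 : K) • ((4 * m : K) • c + r) -
          ((4 * m : K) • ((4 * m : K) • c + r) + ∑ k, e k * ⁅e k, r⁆)) +
          ((4 * m - 6 : K) • r + ∑ k, e k * ⁅e k, r⁆) := by module
      rw [← map_smul, e1, map_add, eq_neg_of_add_eq_zero_left hPc.symm]
      refine add_mem (neg_mem hsum) (ih _ (add_mem (Submodule.smul_mem _ _ hr) hnrmem))
    have hne : (8 * m * (3 - 2 * m) : K) ≠ 0 := by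
      have : ((8 * m * (3 - 2 * m) : ℤ) : K) ≠ 0 := by
        refine Int.cast_ne_zero.mpr (mul_ne_zero (by positivity) ?_)
        omega
      exact_mod_cast this
    exact (Submodule.smul_mem_iff (Subalgebra.toSubmodule A) hne).mp hfin

/-- An even element that commutes with the Dirac operator and its dual lies in every subalgebra
of such elements that contains the two-index symmetries. -/
theorem mem_of_commute_dirac [CharZero K] (h : WeylCliffRelations x y e)
    (hA : ∀ i j, i ≠ j → x i * y j - x j * y i + (2⁻¹ : K) • (e i * e j) ∈ A)
    (hAD : ∀ a ∈ A, Commute a (∑ i, y i * e i)) (hAD' : ∀ a ∈ A, Commute a (∑ i, x i * e i))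
    {d : ℕ} {w : R} (hw : w ∈ weylFilt x y (⨆ m, cliffFilt K e m) d)
    (hwD : Commute w (∑ i, y i * e i)) (hwD' : Commute w (∑ i, x i * e i)) : w ∈ A := by
  have hB {b : R} : b ∈ ⨆ m, cliffFilt K e m ↔ ∃ m, b ∈ cliffFilt K e m :=
    Submodule.mem_iSup_of_directed _ cliffFilt_mono.directed_le
  have hBx (i : ι) (b : R) (hb : b ∈ ⨆ m, cliffFilt K e m) : Commute (x i) b := by
    obtain ⟨m, hm⟩ := hB.mp hb
    exact commute_of_mem_cliffFilt (fun j => (h.ex j i).symm) _ b hm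
  have hBy (i : ι) (b : R) (hb : b ∈ ⨆ m, cliffFilt K e m) : Commute (y i) b := by
    obtain ⟨m, hm⟩ := hB.mp hb
    exact commute_of_mem_cliffFilt (fun j => (h.ey j i).symm) _ b hm
  -- The invariant theorem is applied with M = C_0 · A. Stability of M under L_ij uses that L_ij
  -- commutes with Clifford coefficients and equals O_ij - e_i e_j / 2: the first term is absorbed
  -- by A, the second by C_0.
  have hwM : w ∈ (⨆ m, cliffFilt K e m) * Subalgebra.toSubmodule A := by
    refine h.weyl.mem_of_lie_sum_sq_eq_zero hBx hBy (fun b hb => ?_) (fun i j z hz => ?_) d w hw ?_ ?_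
    · rw [← mul_one b]; exact Submodule.mul_mem_mul hb A.one_mem
    · by_cases hij : i = j
      · subst hij; rw [sub_self, zero_mul]; exact zero_mem _
      induction hz using Submodule.mul_induction_on' with
      | mem_mul_mem b hb a ha =>
        have hc : Commute (x i * y j - x j * y i) b :=
          ((hBx i b hb).mul_left (hBy j b hb)).sub_left ((hBx j b hb).mul_left (hBy i b hb))
        have e1 : (x i * y j - x j * y i) * (b * a) =
            b * ((x i * y j - x j * y i + (2⁻¹ : K) • (e i * e j)) * a) -
              (2⁻¹ : K) • (b * (e i * e j) * a) := by
          rw [← mul_assoc, hc.eq, add_mul, mul_add, smul_mul_assoc, mul_smul_comm]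
          simp only [mul_assoc, add_sub_cancel_right]
        rw [e1]
        refine sub_mem (Submodule.mul_mem_mul hb (A.mul_mem (hA i j hij) ha))
          (Submodule.smul_mem _ _ (Submodule.mul_mem_mul ?_ ha))
        obtain ⟨m, hm⟩ := hB.mp hb
        exact hB.mpr ⟨_, mul_mem_cliffFilt i j m b hm⟩
      | add a _ b _ ha hb => rw [mul_add]; exact add_mem ha hb
    · rw [← h.dirac_mul_dirac (K := K)]; exact (hwD.mul_right hwD).symm.lie_eq
    · rw [← h.diracDual_mul_diracDual (K := K)]; exact (hwD'.mul_right hwD').symm.lie_eq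
  have hP : ∀ z ∈ (⨆ m, cliffFilt K e m) * Subalgebra.toSubmodule A,
      (2 : K) • z - doubleBracket K (∑ i, y i * e i) (∑ i, x i * e i) z ∈ A := by
    intro z hz
    induction hz using Submodule.mul_induction_on' with
    | mem_mul_mem b hb a ha =>
      obtain ⟨m, hm⟩ := hB.mp hb
      rw [doubleBracket_mul_right (hAD a ha) (hAD' a ha), ← smul_mul_assoc, ← sub_mul]
      exact A.mul_mem (h.two_smul_sub_doubleBracket_mem hA hAD hAD' m b hm) ha
    | add a _ b _ ha hb => rw [smul_add, map_add, add_sub_add_comm]; exact add_mem ha hb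
  have := hP w hwM
  rw [doubleBracket_of_commute hwD', sub_zero] at this
  exact (Submodule.smul_mem_iff (Subalgebra.toSubmodule A) two_ne_zero).mp this

end WeylCliffRelations

end DiracInvariants

/-! ### The realization of `so(n)` -/

section Realization

variable {K R ι : Type*} [Field K] [Ring R] [Algebra K R] [Fintype ι]

/-- The quadratic element `∑ X_ij f_i g_j`. -/
def quadratic (f g : ι → R) : Matrix ι ι K →ₗ[K] R where
  toFun X := ∑ i, ∑ j, X i j • (f i * g j)
  map_add' X Y := by simp [add_smul, Finset.sum_add_distrib]
  map_smul' r X := by simp [mul_smul, Finset.smul_sum]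

theorem quadratic_apply (f g : ι → R) (X : Matrix ι ι K) :
    quadratic f g X = ∑ i, ∑ j, X i j • (f i * g j) := rfl

/-- The matrix Y transforms as X Y + Y Xᵀ, which is the commutator when X is skew. -/
theorem lie_quadratic {X : Matrix ι ι K} (hX : X.transpose = -X) {a : R} {f g : ι → R}
    (hf : ∀ k, ⁅a, f k⁆ = ∑ i, X i k • f i) (hg : ∀ k, ⁅a, g k⁆ = ∑ i, X i k • g i)
    (Y : Matrix ι ι K) : ⁅a, quadratic f g Y⁆ = quadratic f g (X * Y - Y * X) := by
  have hX' (i j : ι) : X i j = -X j i := by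
    have := congrFun (congrFun hX j) i
    simpa using this
  have e1 : quadratic f g (X * Y) = ∑ k, ∑ l, Y k l • ((∑ i, X i k • f i) * g l) := by
    simp only [quadratic_apply, Matrix.mul_apply, Finset.sum_mul, Finset.smul_sum, Finset.sum_smul,
      smul_mul_assoc, smul_smul]
    calc _ = ∑ i, ∑ k, ∑ l, (X i k * Y k l) • (f i * g l) :=
          Finset.sum_congr rfl fun i _ => Finset.sum_comm
      _ = ∑ k, ∑ i, ∑ l, (X i k * Y k l) • (f i * g l) := Finset.sum_comm
      _ = _ := Finset.sum_congr rfl fun k _ => Finset.sum_comm.trans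
          (Finset.sum_congr rfl fun l _ => Finset.sum_congr rfl fun i _ => by rw [mul_comm])
  have e2 : quadratic f g (Y * X) = -∑ k, ∑ l, Y k l • (f k * ∑ i, X i l • g i) := by
    simp only [quadratic_apply, Matrix.mul_apply, Finset.mul_sum, Finset.smul_sum, Finset.sum_smul,
      mul_smul_comm, smul_smul, ← Finset.sum_neg_distrib]
    refine Finset.sum_congr rfl fun k _ => Finset.sum_comm.trans
      (Finset.sum_congr rfl fun l _ => Finset.sum_congr rfl fun i _ => ?_)
    rw [hX' l i, mul_neg, neg_smul]
  rw [map_sub, e1, e2, sub_neg_eq_add]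
  simp only [quadratic_apply, lie_sum, lie_smul_eq, lie_mul_eq, hf, hg, smul_add,
    Finset.sum_add_distrib]

/-- The element `∑ X_ij (x_i y_j + e_i e_j / 4)` for a matrix `X`. -/
def rotation (x y e : ι → R) : Matrix ι ι K →ₗ[K] R :=
  quadratic x y + (4⁻¹ : K) • quadratic e e

theorem rotation_apply (x y e : ι → R) (X : Matrix ι ι K) :
    rotation x y e X = quadratic x y X + (4⁻¹ : K) • quadratic e e X := rfl

theorem commute_quadratic {f g : ι → R} {a : R} (hf : ∀ i, Commute a (f i))
    (hg : ∀ i, Commute a (g i)) (X : Matrix ι ι K) : Commute a (quadratic f g X) :=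
  Commute.sum_right _ _ _ fun i _ => Commute.sum_right _ _ _ fun j _ =>
    ((hf i).mul_right (hg j)).smul_right _

variable [DecidableEq ι] {x y e : ι → R}

theorem WeylRelations.lie_quadratic_x (h : WeylRelations x y) (X : Matrix ι ι K) (k : ι) :
    ⁅quadratic x y X, x k⁆ = ∑ i, X i k • x i := by
  rw [← lie_skew, quadratic_apply, lie_sum, ← Finset.sum_neg_distrib]
  refine Finset.sum_congr rfl fun i _ => ?_
  simp only [lie_sum, lie_smul_eq, lie_mul_eq, h.lie_xx, h.lie_xy]
  simp

theorem WeylRelations.lie_quadratic_y (h : WeylRelations x y) {X : Matrix ι ι K} (hX : X.transpose = -X)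
    (k : ι) : ⁅quadratic x y X, y k⁆ = ∑ i, X i k • y i := by
  have hX' (i j : ι) : X i j = -X j i := by
    have := congrFun (congrFun hX j) i
    simpa using this
  rw [← lie_skew, quadratic_apply, Finset.sum_comm, lie_sum, ← Finset.sum_neg_distrib]
  refine Finset.sum_congr rfl fun i _ => ?_
  simp only [lie_sum, lie_smul_eq, lie_mul_eq, h.lie_yy, h.lie_yx, hX' i k]
  simp

/-- One factor 2 comes from the Clifford relation, the other from the row and column terms agreeing
by skewness. This 4 is undone by the 4⁻¹ in `rotation`, so that x, y and e transform alike. -/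
theorem CliffordRelations.lie_quadratic (h : CliffordRelations e) {X : Matrix ι ι K}
    (hX : X.transpose = -X) (k : ι) : ⁅quadratic e e X, e k⁆ = (4 : K) • ∑ i, X i k • e i := by
  have hX' (i j : ι) : X i j = -X j i := by
    have := congrFun (congrFun hX j) i
    simpa using this
  have key (i j : ι) : X i j • -⁅e k, e i * e j⁆ =
      (if k = j then (2 : K) • X i k • e i else 0) - (if k = i then (2 : K) • X k j • e j else 0) := by
    have := h.lie_mul_mul k i j 1
    have hone : ⁅e k, (1 : R)⁆ = 0 := (Commute.one_right (e k)).lie_eq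
    simp only [mul_one, hone, mul_zero, add_zero] at this
    rw [this]
    split_ifs with h1 h2 h2
    · subst h1; subst h2; simp
    · subst h1; rw [two_mul, zero_mul]; module
    · subst h2; rw [two_mul, zero_mul]; module
    · simp
  rw [← lie_skew, quadratic_apply]
  simp only [lie_sum, lie_smul_eq, ← Finset.sum_neg_distrib, ← smul_neg, key,
    Finset.sum_sub_distrib]
  rw [Finset.sum_comm (f := fun i j => if k = i then (2 : K) • X k j • e j else 0)]
  simp only [Finset.sum_ite_eq, Finset.mem_univ, if_true, ← Finset.smul_sum]
  simp only [hX' k, neg_smul, Finset.sum_neg_distrib]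
  module

namespace WeylCliffRelations

theorem lie_rotation_x (h : WeylCliffRelations x y e) (X : Matrix ι ι K) (k : ι) :
    ⁅rotation x y e X, x k⁆ = ∑ i, X i k • x i := by
  have hc := (commute_quadratic (fun i => (h.ex i k).symm) (fun i => (h.ex i k).symm) X).symm
  rw [rotation_apply, add_lie, h.weyl.lie_quadratic_x, (hc.smul_left _).lie_eq, add_zero]

theorem lie_rotation_y (h : WeylCliffRelations x y e) {X : Matrix ι ι K} (hX : X.transpose = -X) (k : ι) :
    ⁅rotation x y e X, y k⁆ = ∑ i, X i k • y i := by
  have hc := (commute_quadratic (fun i => (h.ey i k).symm) (fun i => (h.ey i k).symm) X).symm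
  rw [rotation_apply, add_lie, h.weyl.lie_quadratic_y hX, (hc.smul_left _).lie_eq, add_zero]

theorem lie_rotation_e [CharZero K] (h : WeylCliffRelations x y e) {X : Matrix ι ι K}
    (hX : X.transpose = -X) (k : ι) : ⁅rotation x y e X, e k⁆ = ∑ i, X i k • e i := by
  have hc := (commute_quadratic (h.ex k) (h.ey k) X).symm
  rw [rotation_apply, add_lie, hc.lie_eq, zero_add, ← lie_skew, lie_smul_eq, ← smul_neg, lie_skew,
    h.cliff.lie_quadratic hX, smul_smul, inv_mul_cancel₀ (by norm_num : (4 : K) ≠ 0), one_smul]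

theorem lie_rotation_rotation [CharZero K] (h : WeylCliffRelations x y e) {X : Matrix ι ι K}
    (hX : X.transpose = -X) (Y : Matrix ι ι K) :
    ⁅rotation x y e X, rotation x y e Y⁆ = rotation x y e (X * Y - Y * X) := by
  rw [rotation_apply x y e Y, lie_add, lie_smul_eq,
    lie_quadratic hX (h.lie_rotation_x X) (h.lie_rotation_y hX),
    lie_quadratic hX (h.lie_rotation_e hX) (h.lie_rotation_e hX), rotation_apply]

theorem sum_mul_eq_quadratic (f g : ι → R) : ∑ i, f i * g i = quadratic f g (1 : Matrix ι ι K) := by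
  simp [quadratic_apply, Matrix.one_apply]

/-- The Dirac operator is the quadratic element of the identity matrix, which commutes with X. -/
theorem commute_rotation_dirac [CharZero K] (h : WeylCliffRelations x y e) {X : Matrix ι ι K}
    (hX : X.transpose = -X) : Commute (rotation x y e X) (∑ i, y i * e i) := by
  rw [commute_iff_lie_eq, sum_mul_eq_quadratic (K := K),
    lie_quadratic hX (h.lie_rotation_y hX) (h.lie_rotation_e hX), mul_one, one_mul, sub_self,
    map_zero]

theorem commute_rotation_diracDual [CharZero K] (h : WeylCliffRelations x y e) {X : Matrix ι ι K}
    (hX : X.transpose = -X) : Commute (rotation x y e X) (∑ i, x i * e i) := by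
  rw [commute_iff_lie_eq, sum_mul_eq_quadratic (K := K),
    lie_quadratic hX (h.lie_rotation_x X) (h.lie_rotation_e hX), mul_one, one_mul, sub_self,
    map_zero]

theorem quadratic_single_sub (f g : ι → R) (i j : ι) :
    quadratic f g (Matrix.single i j 1 - Matrix.single j i 1 : Matrix ι ι K) =
      f i * g j - f j * g i := by
  have (a b : ι) : quadratic f g (Matrix.single a b 1 : Matrix ι ι K) = f a * g b := by
    simp [quadratic_apply, Matrix.single_apply, ite_and, ite_smul]
  rw [map_sub, this, this]

theorem rotation_single_sub [CharZero K] (h : WeylCliffRelations x y e) {i j : ι} (hij : i ≠ j) :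
    rotation x y e (Matrix.single i j 1 - Matrix.single j i 1 : Matrix ι ι K) =
      x i * y j - x j * y i + (2⁻¹ : K) • (e i * e j) := by
  rw [rotation_apply, quadratic_single_sub, quadratic_single_sub, h.cliff.mul_comm_eq j i,
    if_neg hij.symm]
  have : (4⁻¹ : K) * 2 = 2⁻¹ := by norm_num
  rw [zero_sub, sub_neg_eq_add, ← two_smul K, smul_smul, this]

end WeylCliffRelations

end Realization

/-! ### The total angular momentum algebra -/

section Tama

variable {V : Type*} [AddCommGroup V] [Module ℂ V]

theorem WeylAlgebra.ι_mul_ι_sub {M : Type*} [AddCommGroup M] [Module ℂ M]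
    (ω : LinearMap.BilinForm ℂ M) (v v' : M) :
    WeylAlgebra.ι ω v * WeylAlgebra.ι ω v' - WeylAlgebra.ι ω v' * WeylAlgebra.ι ω v =
      algebraMap ℂ (WeylAlgebra ω) (ω v v') := by
  have := RingQuot.mkAlgHom_rel ℂ (WeylRel.comm (ω := ω) v v')
  rw [map_sub, map_mul, map_mul, AlgHom.commutes] at this
  exact this

theorem WeylAlgebra.adjoin_range_ι {M : Type*} [AddCommGroup M] [Module ℂ M]
    (ω : LinearMap.BilinForm ℂ M) : Algebra.adjoin ℂ (Set.range (WeylAlgebra.ι ω)) = ⊤ := by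
  have h : Set.range (WeylAlgebra.ι ω) =
      (RingQuot.mkAlgHom ℂ (WeylRel ω)) '' Set.range (TensorAlgebra.ι ℂ) := by
    rw [← Set.range_comp]; rfl
  have h' := AlgHom.map_adjoin (RingQuot.mkAlgHom ℂ (WeylRel ω)) (Set.range (TensorAlgebra.ι ℂ))
  rw [TensorAlgebra.adjoin_range_ι, Algebra.map_top,
    AlgHom.range_eq_top _ |>.mpr (RingQuot.mkAlgHom_surjective ℂ _)] at h'
  rw [h]
  exact h'.symm

variable (σ : LinearMap.BilinForm ℂ V) {n : ℕ} (y : Module.Basis (Fin n) ℂ V)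

/-- The generator `x_i` of the Weyl-Clifford algebra. -/
def genX (i : Fin n) : WeylCliff σ := wx y i ⊗ₜ[ℂ] 1

/-- The generator `y_i` of the Weyl-Clifford algebra. -/
def genY (i : Fin n) : WeylCliff σ := wy y i ⊗ₜ[ℂ] 1

/-- The generator `e_i` of the Weyl-Clifford algebra. -/
def genE (i : Fin n) : WeylCliff σ := 1 ⊗ₜ[ℂ] ce σ y i

theorem dirac_eq : dirac σ y = ∑ i, genY σ y i * genE σ y i := by
  simp [dirac, genY, genE]

theorem diracDual_eq : diracDual σ y = ∑ i, genX σ y i * genE σ y i := by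
  simp [diracDual, genX, genE]

theorem twoIndex_eq (i j : Fin n) : twoIndex σ y i j =
    genX σ y i * genY σ y j - genX σ y j * genY σ y i +
      (2⁻¹ : ℂ) • (genE σ y i * genE σ y j) := by
  simp [twoIndex, angMom, genX, genY, genE, TensorProduct.sub_tmul]

theorem symplecticForm_apply (v v' : V × Module.Dual ℂ V) :
    symplecticForm V v v' = v'.2 v.1 - v.2 v'.1 := rfl

theorem weylRelations_wx_wy : WeylRelations (wx y) (wy y) where
  xx i j := by
    have := WeylAlgebra.ι_mul_ι_sub (symplecticForm V) (0, y.coord i) (0, y.coord j)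
    rw [← sub_eq_zero]
    refine this.trans ?_
    rw [symplecticForm_apply]
    simp
  yy i j := by
    have := WeylAlgebra.ι_mul_ι_sub (symplecticForm V) (y i, 0) (y j, 0)
    rw [← sub_eq_zero]
    refine this.trans ?_
    rw [symplecticForm_apply]
    simp
  yx i j := by
    have := WeylAlgebra.ι_mul_ι_sub (symplecticForm V) (y i, 0) (0, y.coord j)
    rw [← sub_eq_iff_eq_add']
    refine this.trans ?_
    by_cases hij : i = j
    · subst hij; rw [symplecticForm_apply]; simp
    · rw [symplecticForm_apply]; simp [hij]

variable {σ}

theorem cliffordRelations_ce (hy : ∀ i j, σ (y i) (y j) = if i = j then 1 else 0) :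
    CliffordRelations (ce σ y) := by
  intro i j
  have := CliffordAlgebra.ι_mul_ι_add_swap (Q := σ.toQuadraticMap) (y i) (y j)
  refine this.trans ?_
  rw [LinearMap.BilinMap.polar_toQuadraticMap, hy, hy]
  by_cases hij : i = j
  · subst hij; simp; norm_num
  · simp [hij, Ne.symm hij]

theorem weylCliffRelations_gen (hy : ∀ i j, σ (y i) (y j) = if i = j then 1 else 0) :
    WeylCliffRelations (genX σ y) (genY σ y) (genE σ y) where
  weyl :=
    { xx := fun i j => by simp [genX, (weylRelations_wx_wy y).xx i j]
      yy := fun i j => by simp [genY, (weylRelations_wx_wy y).yy i j]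
      yx := fun i j => by
        simp only [genX, genY, Algebra.TensorProduct.tmul_mul_tmul, mul_one,
          (weylRelations_wx_wy y).yx i j, TensorProduct.add_tmul]
        split_ifs <;> simp [Algebra.TensorProduct.one_def] }
  cliff := fun i j => by
    simp only [genE, Algebra.TensorProduct.tmul_mul_tmul, mul_one, ← TensorProduct.tmul_add,
      cliffordRelations_ce y hy i j]
    split_ifs
    · exact map_ofNat (Algebra.TensorProduct.includeRight : Cliff σ →ₐ[ℂ] WeylCliff σ) 2
    · simp
  ex := fun i j => by simp [genE, genX, Commute, SemiconjBy]
  ey := fun i j => by simp [genE, genY, Commute, SemiconjBy]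

/-- The centralizer of an even a is stable under parity and products, hence under the graded
commutator. It is a Lie sub-superalgebra, and contains `spo` once it contains the two generators. -/
theorem mem_tama_of_commute {a : WeylCliff σ} (ha : parity σ a = a)
    (h : Commute a (dirac σ y)) (h' : Commute a (diracDual σ y)) : a ∈ tama σ y := by
  let S : Submodule ℂ (WeylCliff σ) := Subalgebra.toSubmodule (Subalgebra.centralizer ℂ {a})
  have hS {s : WeylCliff σ} : s ∈ S ↔ Commute a s := by
    simp [S, Subalgebra.mem_centralizer_iff, Commute, SemiconjBy]
  have hparity : ∀ s ∈ S, parity σ s ∈ S := fun s hs => by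
    rw [hS] at hs ⊢
    simpa [ha] using hs.map (parity σ)
  have hodd : ∀ s ∈ S, oddProj σ s ∈ S := fun s hs =>
    S.smul_mem _ (S.sub_mem hs (hparity s hs))
  have hmul : ∀ s ∈ S, ∀ t ∈ S, s * t ∈ S := fun s hs t ht =>
    (Subalgebra.centralizer ℂ {a}).mul_mem hs ht
  have hle : spo σ y ≤ S := sInf_le ⟨⟨hparity, fun s hs t ht =>
    S.add_mem (S.sub_mem (hmul s hs t ht) (hmul t ht s hs))
      (S.smul_mem _ (hmul _ (hodd t ht) _ (hodd s hs)))⟩, hS.mpr h, hS.mpr h'⟩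
  intro s hs
  have h0 : oddProj σ a = 0 := by simp [oddProj, ha]
  rw [superBracket, h0, zero_mul, smul_zero, add_zero, (hS.mp (hle hs)).eq, sub_self]

theorem commute_of_mem_tama {a s : WeylCliff σ} (ha : a ∈ tama σ y) (hpa : parity σ a = a)
    (hs : s ∈ spo σ y) : Commute a s := by
  have h0 : oddProj σ a = 0 := by simp [oddProj, hpa]
  have := ha s hs
  rw [superBracket, h0, zero_mul, smul_zero, add_zero] at this
  exact (sub_eq_zero.mp this).symm

theorem dirac_mem_spo : dirac σ y ∈ spo σ y :=
  Submodule.mem_sInf.mpr fun _ hS => hS.2.1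

theorem diracDual_mem_spo : diracDual σ y ∈ spo σ y :=
  Submodule.mem_sInf.mpr fun _ hS => hS.2.2

theorem add_parity_mem_gradedPart (a : WeylCliff σ) : a + parity σ a ∈ gradedPart σ 0 := by
  induction a using TensorProduct.induction_on with
  | zero => simp
  | add a b ha hb => rw [map_add, add_add_add_comm]; exact add_mem ha hb
  | tmul w c =>
    have hc : c + CliffordAlgebra.involute c ∈ CliffordAlgebra.evenOdd σ.toQuadraticMap 0 := by
      have htop : c ∈ CliffordAlgebra.evenOdd σ.toQuadraticMap 0 ⊔
          CliffordAlgebra.evenOdd σ.toQuadraticMap 1 := by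
        rw [(CliffordAlgebra.evenOdd_isCompl σ.toQuadraticMap).sup_eq_top]; trivial
      obtain ⟨c0, h0, c1, h1, rfl⟩ := Submodule.mem_sup.mp htop
      rw [map_add, CliffordAlgebra.involute_eq_of_mem_even h0,
        CliffordAlgebra.involute_eq_of_mem_odd h1]
      have : c0 + c1 + (c0 + -c1) = c0 + c0 := by abel
      rw [this]; exact add_mem h0 h0
    refine ⟨w ⊗ₜ ⟨_, hc⟩, ?_⟩
    simp [parity, TensorProduct.tmul_add]

theorem mem_gradedPart_zero_iff {a : WeylCliff σ} : a ∈ gradedPart σ 0 ↔ parity σ a = a := by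
  refine ⟨fun h => by simpa using parity_of_mem σ h, fun h => ?_⟩
  have h2 := add_parity_mem_gradedPart a
  rw [h, ← two_smul ℂ] at h2
  exact (Submodule.smul_mem_iff _ two_ne_zero).mp h2

theorem one_tmul_mem_cliffFilt {c : Cliff σ} (hc : c ∈ CliffordAlgebra.evenOdd σ.toQuadraticMap 0) :
    ∃ m, (1 ⊗ₜ[ℂ] c : WeylCliff σ) ∈ cliffFilt ℂ (genE σ y) m := by
  induction c, hc using CliffordAlgebra.even_induction with
  | algebraMap r =>
    refine ⟨1, ?_⟩
    have : (1 ⊗ₜ[ℂ] algebraMap ℂ (Cliff σ) r : WeylCliff σ) = algebraMap ℂ _ r :=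
      (Algebra.TensorProduct.includeRight : Cliff σ →ₐ[ℂ] WeylCliff σ).commutes r
    rw [this]
    exact algebraMap_mem_cliffFilt 0 r
  | add a b _ _ ha hb =>
    obtain ⟨m, hm⟩ := ha
    obtain ⟨k, hk⟩ := hb
    refine ⟨max m k, ?_⟩
    rw [TensorProduct.tmul_add]
    exact add_mem (cliffFilt_mono (le_max_left m k) hm) (cliffFilt_mono (le_max_right m k) hk)
  | ι_mul_ι_mul v w c _ ih =>
    obtain ⟨m, hm⟩ := ih
    refine ⟨m + 1, ?_⟩
    have hι (v : V) : (1 ⊗ₜ[ℂ] CliffordAlgebra.ι σ.toQuadraticMap v : WeylCliff σ) =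
        ∑ i, y.repr v i • genE σ y i := by
      conv_lhs => rw [← y.sum_repr v, map_sum, TensorProduct.tmul_sum]
      simp only [map_smul, TensorProduct.tmul_smul]
      rfl
    have hprod : (1 ⊗ₜ[ℂ] (CliffordAlgebra.ι σ.toQuadraticMap v *
        CliffordAlgebra.ι σ.toQuadraticMap w * c) : WeylCliff σ) =
        ∑ i, ∑ j, (y.repr v i * y.repr w j) • (genE σ y i * genE σ y j * (1 ⊗ₜ[ℂ] c)) := by
      have e1 : (1 ⊗ₜ[ℂ] (CliffordAlgebra.ι σ.toQuadraticMap v *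
          CliffordAlgebra.ι σ.toQuadraticMap w * c) : WeylCliff σ) =
          (1 ⊗ₜ[ℂ] CliffordAlgebra.ι σ.toQuadraticMap v) *
          (1 ⊗ₜ[ℂ] CliffordAlgebra.ι σ.toQuadraticMap w) * (1 ⊗ₜ[ℂ] c) := by simp
      rw [e1, hι, hι, Finset.sum_mul_sum, Finset.sum_mul]
      refine Finset.sum_congr rfl fun i _ => ?_
      rw [Finset.sum_mul]
      refine Finset.sum_congr rfl fun j _ => ?_
      rw [smul_mul_smul_comm, smul_mul_assoc]
    rw [hprod]
    exact sum_mem fun i _ => sum_mem fun j _ =>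
      Submodule.smul_mem _ _ (mul_mul_mem_cliffFilt i j hm)

/-- The union of the filtration contains the even Clifford elements and is stable under left
multiplication by the Weyl generators, so by the whole Weyl algebra. -/
theorem gradedPart_zero_le_weylFilt {a : WeylCliff σ} (ha : a ∈ gradedPart σ 0) :
    ∃ d, a ∈ weylFilt (genX σ y) (genY σ y) (⨆ m, cliffFilt ℂ (genE σ y) m) d := by
  have hdir := weylFilt_mono (x := genX σ y) (y := genY σ y)
    (B := ⨆ m, cliffFilt ℂ (genE σ y) m)
  rw [← Submodule.mem_iSup_of_directed _ hdir.directed_le]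
  obtain ⟨S, hS⟩ : ∃ S, S =
    ⨆ d, weylFilt (genX σ y) (genY σ y) (⨆ m, cliffFilt ℂ (genE σ y) m) d := ⟨_, rfl⟩
  have hmem {z : WeylCliff σ} : z ∈ S ↔
      ∃ d, z ∈ weylFilt (genX σ y) (genY σ y) (⨆ m, cliffFilt ℂ (genE σ y) m) d := by
    rw [hS, Submodule.mem_iSup_of_directed _ hdir.directed_le]
  rw [← hS]
  have hmul (w : WeylAlgebra (symplecticForm V)) : ∀ z ∈ S, (w ⊗ₜ[ℂ] 1) * z ∈ S := by
    have hw : w ∈ Algebra.adjoin ℂ (Set.range (WeylAlgebra.ι (symplecticForm V))) := by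
      rw [WeylAlgebra.adjoin_range_ι]; trivial
    induction hw using Algebra.adjoin_induction with
    | mem w hw =>
      obtain ⟨⟨v, f⟩, rfl⟩ := hw
      intro z hz
      obtain ⟨d, hd⟩ := hmem.mp hz
      have hvf : ((v, f) : V × Module.Dual ℂ V) =
          ∑ i, (y.repr v i • ((y i, 0) : V × Module.Dual ℂ V) +
            f (y i) • ((0, y.coord i) : V × Module.Dual ℂ V)) := by
        refine Prod.ext ?_ ?_
        · simp [Prod.fst_sum]
        · refine y.ext fun j => ?_
          simp [Prod.snd_sum]
      have hι : (WeylAlgebra.ι (symplecticForm V) (v, f) ⊗ₜ[ℂ] 1 : WeylCliff σ) =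
          ∑ i, (y.repr v i • genY σ y i + f (y i) • genX σ y i) := by
        rw [hvf, map_sum, TensorProduct.sum_tmul]
        refine Finset.sum_congr rfl fun i _ => ?_
        rw [map_add, map_smul, map_smul, TensorProduct.add_tmul, ← TensorProduct.smul_tmul',
          ← TensorProduct.smul_tmul']
        rfl
      rw [hι, Finset.sum_mul]
      refine hmem.mpr ⟨d + 1, sum_mem fun i _ => ?_⟩
      rw [add_mul, smul_mul_assoc, smul_mul_assoc]
      exact add_mem (Submodule.smul_mem _ _ (y_mul_mem_weylFilt i hd))
        (Submodule.smul_mem _ _ (x_mul_mem_weylFilt i hd))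
    | algebraMap r =>
      intro z hz
      have : (algebraMap ℂ (WeylAlgebra (symplecticForm V)) r ⊗ₜ[ℂ] 1 : WeylCliff σ) =
          algebraMap ℂ _ r := rfl
      rw [this, ← Algebra.smul_def]
      exact S.smul_mem r hz
    | add a b _ _ ha hb =>
      intro z hz
      rw [TensorProduct.add_tmul, add_mul]; exact S.add_mem (ha z hz) (hb z hz)
    | mul a b _ _ ha hb =>
      intro z hz
      have : ((a * b) ⊗ₜ[ℂ] 1 : WeylCliff σ) = (a ⊗ₜ[ℂ] 1) * (b ⊗ₜ[ℂ] 1) := by simp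
      rw [this, mul_assoc]; exact ha _ (hb z hz)
  obtain ⟨t, rfl⟩ := ha
  induction t using TensorProduct.induction_on with
  | zero => rw [map_zero]; exact zero_mem _
  | add a b ha hb => rw [map_add]; exact add_mem ha hb
  | tmul w c =>
    obtain ⟨m, hm⟩ := one_tmul_mem_cliffFilt y c.2
    have : (LinearMap.lTensor (WeylAlgebra (symplecticForm V))
        (CliffordAlgebra.evenOdd σ.toQuadraticMap 0).subtype) (w ⊗ₜ[ℂ] c) =
        ((w ⊗ₜ[ℂ] 1) * (1 ⊗ₜ[ℂ] (c : Cliff σ)) : WeylCliff σ) := by simp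
    rw [this]
    exact hmul w _ (hmem.mpr ⟨1, le_weylFilt_succ 0 (Submodule.mem_iSup_of_mem m hm)⟩)

theorem parity_rotation (X : Matrix (Fin n) (Fin n) ℂ) :
    parity σ (rotation (genX σ y) (genY σ y) (genE σ y) X) =
      rotation (genX σ y) (genY σ y) (genE σ y) X := by
  have hx (i : Fin n) : parity σ (genX σ y i) = genX σ y i := by simp [parity, genX]
  have hy (i : Fin n) : parity σ (genY σ y i) = genY σ y i := by simp [parity, genY]
  have he (i : Fin n) : parity σ (genE σ y i) = -genE σ y i := by
    simp [parity, genE, ce, TensorProduct.tmul_neg]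
  simp [rotation_apply, quadratic_apply, hx, hy, he]

/-- The Lie algebra homomorphism `so(n) → 𝔒` that sends `X_ij` to `O_ij`. -/
def soToTama (hy : ∀ i j, σ (y i) (y j) = if i = j then 1 else 0) :
    LieAlgebra.Orthogonal.so (Fin n) ℂ →ₗ⁅ℂ⁆ tama σ y where
  toFun X := ⟨rotation (genX σ y) (genY σ y) (genE σ y) X.1, by
    have hX := (LieAlgebra.Orthogonal.mem_so _ _ X.1).mp X.2
    refine mem_tama_of_commute y (parity_rotation y _) ?_ ?_
    · rw [dirac_eq]; exact (weylCliffRelations_gen y hy).commute_rotation_dirac hX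
    · rw [diracDual_eq]; exact (weylCliffRelations_gen y hy).commute_rotation_diracDual hX⟩
  map_add' X Y := Subtype.ext (map_add (rotation _ _ _) X.1 Y.1)
  map_smul' r X := Subtype.ext (map_smul (rotation _ _ _) r X.1)
  map_lie' {X Y} := Subtype.ext
    ((weylCliffRelations_gen y hy).lie_rotation_rotation
      ((LieAlgebra.Orthogonal.mem_so _ _ X.1).mp X.2) Y.1).symm

/-! ### Uniqueness: the X_ij span so(n) -/

theorem two_smul_eq_sum_soX (X : LieAlgebra.Orthogonal.so (Fin n) ℂ) :
    (2 : ℂ) • X = ∑ i, ∑ j, X.1 i j • soX i j := by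
  have hX := (LieAlgebra.Orthogonal.mem_so _ _ X.1).mp X.2
  have h1 : X.1 = ∑ i, ∑ j, X.1 i j • Matrix.single i j (1 : ℂ) := by
    conv_lhs => rw [Matrix.matrix_eq_sum_single X.1]
    simp
  have h2 : X.1.transpose = ∑ i, ∑ j, X.1 i j • Matrix.single j i (1 : ℂ) := by
    conv_lhs => rw [h1]
    simp [Matrix.transpose_sum]
  refine Subtype.ext ?_
  have h3 : ((∑ i, ∑ j, X.1 i j • soX i j : LieAlgebra.Orthogonal.so (Fin n) ℂ) :
      Matrix (Fin n) (Fin n) ℂ) = ∑ i, ∑ j, X.1 i j • Matrix.single i j (1 : ℂ) -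
        ∑ i, ∑ j, X.1 i j • Matrix.single j i (1 : ℂ) := by
    simp [soX, smul_sub, Finset.sum_sub_distrib]
  rw [h3, ← h1, ← h2, hX, sub_neg_eq_add, ← two_smul ℂ]
  rfl

theorem soX_swap (i j : Fin n) : soX j i = -soX i j :=
  Subtype.ext (neg_sub _ _).symm

theorem so_linearMap_ext {M : Type*} [AddCommGroup M] [Module ℂ M]
    {f g : LieAlgebra.Orthogonal.so (Fin n) ℂ →ₗ[ℂ] M}
    (h : ∀ i j : Fin n, i < j → f (soX i j) = g (soX i j)) : f = g := by
  have hall (i j : Fin n) : f (soX i j) = g (soX i j) := by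
    rcases lt_trichotomy i j with hij | rfl | hij
    · exact h i j hij
    · have : soX i i = 0 := Subtype.ext (sub_self _)
      rw [this, map_zero, map_zero]
    · rw [soX_swap, map_neg, map_neg, h j i hij]
  refine LinearMap.ext fun X => ?_
  have h2 : (2 : ℂ) • f X = (2 : ℂ) • g X := by
    rw [← map_smul, ← map_smul, two_smul_eq_sum_soX]
    simp only [map_sum, map_smul, hall]
  exact smul_right_injective M (two_ne_zero (α := ℂ)) h2

theorem uea_hom_ext {L A : Type*} [LieRing L] [LieAlgebra ℂ L] [Ring A] [Algebra ℂ A]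
    {f g : UniversalEnvelopingAlgebra ℂ L →ₐ[ℂ] A}
    (h : ∀ X, f (UniversalEnvelopingAlgebra.ι ℂ X) = g (UniversalEnvelopingAlgebra.ι ℂ X)) :
    f = g :=
  UniversalEnvelopingAlgebra.hom_ext ℂ (LieHom.ext h)

theorem uea_so_hom_ext {A : Type*} [Ring A] [Algebra ℂ A]
    {f g : UniversalEnvelopingAlgebra ℂ (LieAlgebra.Orthogonal.so (Fin n) ℂ) →ₐ[ℂ] A}
    (h : ∀ i j : Fin n, i < j → f (UniversalEnvelopingAlgebra.ι ℂ (soX i j)) =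
      g (UniversalEnvelopingAlgebra.ι ℂ (soX i j))) : f = g := by
  refine uea_hom_ext fun X => ?_
  let ι' : LieAlgebra.Orthogonal.so (Fin n) ℂ →ₗ[ℂ]
      UniversalEnvelopingAlgebra ℂ (LieAlgebra.Orthogonal.so (Fin n) ℂ) :=
    (UniversalEnvelopingAlgebra.ι ℂ : LieAlgebra.Orthogonal.so (Fin n) ℂ →ₗ⁅ℂ⁆ _)
  exact LinearMap.congr_fun
    (so_linearMap_ext (f := f.toLinearMap ∘ₗ ι') (g := g.toLinearMap ∘ₗ ι') h) X

theorem exists_ueaHom (hy : ∀ i j, σ (y i) (y j) = if i = j then 1 else 0) :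
    ∃ φ : UniversalEnvelopingAlgebra ℂ (LieAlgebra.Orthogonal.so (Fin n) ℂ) →ₐ[ℂ] tama σ y,
      ∀ X, (φ (UniversalEnvelopingAlgebra.ι ℂ X) : WeylCliff σ) =
        rotation (genX σ y) (genY σ y) (genE σ y) X.1 :=
  ⟨UniversalEnvelopingAlgebra.lift ℂ (soToTama y hy), fun X => by
    rw [UniversalEnvelopingAlgebra.lift_ι_apply]; rfl⟩

end Tama

end AngularMomentum

end

open AngularMomentum in
theorem mainTheorem3 {V : Type*} [AddCommGroup V] [Module ℂ V]
    (σ : LinearMap.BilinForm ℂ V) (n : ℕ) (y : Module.Basis (Fin n) ℂ V)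
    (hy : ∀ i j, σ (y i) (y j) = if i = j then 1 else 0) :
    ∃ φ : UniversalEnvelopingAlgebra ℂ (LieAlgebra.Orthogonal.so (Fin n) ℂ) →ₐ[ℂ] tama σ y,
      (∀ i j : Fin n, i < j →
        (φ (UniversalEnvelopingAlgebra.ι ℂ (soX i j)) : WeylCliff σ) = twoIndex σ y i j) ∧
      (∀ ψ : UniversalEnvelopingAlgebra ℂ (LieAlgebra.Orthogonal.so (Fin n) ℂ) →ₐ[ℂ] tama σ y,
        (∀ i j : Fin n, i < j →
          (ψ (UniversalEnvelopingAlgebra.ι ℂ (soX i j)) : WeylCliff σ) = twoIndex σ y i j) →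
        ψ = φ) ∧
      Subalgebra.toSubmodule (φ.range.map (tama σ y).val) = tamaEven σ y := by
  have hrel := weylCliffRelations_gen y hy
  obtain ⟨φ, hφ⟩ := exists_ueaHom y hy
  have hφ2 (i j : Fin n) (hij : i ≠ j) :
      (φ (UniversalEnvelopingAlgebra.ι ℂ (soX i j)) : WeylCliff σ) = twoIndex σ y i j := by
    rw [hφ, twoIndex_eq]; exact hrel.rotation_single_sub hij
  refine ⟨φ, fun i j hij => hφ2 i j hij.ne, fun ψ hψ => uea_so_hom_ext fun i j hij =>
    Subtype.ext ((hψ i j hij).trans (hφ2 i j hij.ne).symm), ?_⟩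
  -- Parity fixes the images of the Lie algebra elements, hence the whole image is even.
  have hpar : (parity σ).comp ((tama σ y).val.comp φ) = (tama σ y).val.comp φ := by
    refine uea_hom_ext fun X => ?_
    change parity σ (φ (UniversalEnvelopingAlgebra.ι ℂ X)) = φ (UniversalEnvelopingAlgebra.ι ℂ X)
    rw [hφ, parity_rotation]
  have hrange {a : WeylCliff σ} (ha : a ∈ φ.range.map (tama σ y).val) :
      a ∈ tama σ y ∧ parity σ a = a := by
    obtain ⟨_, ⟨u, rfl⟩, rfl⟩ := ha
    exact ⟨(φ u).2, AlgHom.congr_fun hpar u⟩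
  refine le_antisymm (fun a ha => ⟨(hrange ha).1, mem_gradedPart_zero_iff.mpr (hrange ha).2⟩) ?_
  rintro a ⟨ha, ha0⟩
  have hpa := mem_gradedPart_zero_iff.mp ha0
  obtain ⟨d, hd⟩ := gradedPart_zero_le_weylFilt y ha0
  -- The image itself serves as A: it contains the O_ij, and its members are even elements of 𝔒, so
  -- they commute with D and D' in the ordinary sense.
  refine hrel.mem_of_commute_dirac (A := φ.range.map (tama σ y).val) (fun i j hij => ?_)
    (fun b hb => ?_) (fun b hb => ?_) hd ?_ ?_
  · rw [← twoIndex_eq, ← hφ2 i j hij]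
    exact ⟨_, ⟨_, rfl⟩, rfl⟩
  · rw [← dirac_eq]
    exact commute_of_mem_tama y (hrange hb).1 (hrange hb).2 (dirac_mem_spo y)
  · rw [← diracDual_eq]
    exact commute_of_mem_tama y (hrange hb).1 (hrange hb).2 (diracDual_mem_spo y)
  · rw [← dirac_eq]; exact commute_of_mem_tama y ha hpa (dirac_mem_spo y)
  · rw [← diracDual_eq]; exact commute_of_mem_tama y ha hpa (diracDual_mem_spo y)
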